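/- **Setting.** Let $A,Q\in\mathbb R^{n\times n}$, $B\in\mathbb R^{n\times m}$, $R\in\mathbb R^{m\times m}$, $q,d\in\mathbb R^n$, with $Q$ and $R$ symmetric (possibly indefinite), and let $\nu$ be an integer. On a probability space let $\bar x$ be a random vector in $\mathbb R^n$, $\mathbf N$ a random variable with values in $\{2,\dots,\nu\}$ and $(w_t)_{t\ge1}$, $(v_t)_{t\ge1}$ sequences of random vectors in $\mathbb R^n$ (process and observation noise). For $N\in\{2,\dots,\nu\}$ and $x\in\mathbb R^n$, the *forward problem* for $(N,x)$ is to minimize $$J_N=\mathbb E\Big[\tfrac12x_\nu^TQx_\nu+q^Tx_\nu+\sum_{t=\nu-N+1}^{\nu-1}\big(\tfrac12x_t^TQx_t+q^Tx_t+\tfrac12u_t^TRu_t\big)\Big]$$ subject to $x_1=x$; $x_{t+1}=x_t$ and $u_t=0$ for $1\le t\le\nu-N$; and $x_{t+1}=Ax_t+Bu_t+d+w_t$ for $\nu-N+1\le t\le\nu-1$. The expectation is over the noise $w$. The minimum is over state feedbacks $u_t=\mu_t(x_t)$ with $\mu_t:\mathbb R^n\to\mathbb R^m$ measurable and $\mathbb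 E\|u_t\|^2<\infty$. **Assumptions.** (i) *I.i.d.* The random elements $(\bar x,\mathbf N)$, $(w_t)_{t\ge1}$, $(v_t)_{t\ge1}$ are mutually independent. The $w_t$ are i.i.d. with mean $0$ and (finite) covariance $\Sigma_w$; the $v_t$ are i.i.d. with mean $0$ and (finite) covariance $\Sigma_v$. (ii) *Persistent excitation.* $\mathbb E\|\bar x\|^2<\infty$, and for each $N\in\{2,\dots,\nu\}$ with $\mathbb P(\mathbf N=N)>0$ and each $\chi\in\mathbb R^n$ there is $\rho>0$ such that $\mathbb P(\|\bar x-\rho\chi\|<\epsilon\mid\mathbf N=N)>0$ for all $\epsilon>0$. **Notation.** $M^\dagger$ is the Moore–Penrose pseudo-inverse. For given $P_{t+1}\in\mathbb R^{n\times n}$, $\eta_{t+1}\in\mathbb R^n$ put $$\mathbf S_t=B^TP_{t+1}A,\qquad \mathbf R_t=B^TP_{t+1}B+R,\qquad g_t=B^T\eta_{t+1}+B^TP_{t+1}d.$$ **Theorem.** Under (i) and (ii) the following four statements are equivalent. 1. For every $N\in\{2,\dots,\nu\}$ and for almost every $x$ with respect to the distribution of $\bar x$, the forward problem for $(N,x)$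 has an optimal solution. 2. For the sequences generated by $P_\nu=Q$, $\eta_\nu=q$ and, for $t=\nu-1,\dots,1$, $$P_t=A^TP_{t+1}A+Q-A^TP_{t+1}B(B^TP_{t+1}B+R)^\dagger B^TP_{t+1}A,$$ $$\eta_t=\big(A-B(B^TP_{t+1}B+R)^\dagger B^TP_{t+1}A\big)^T(\eta_{t+1}+P_{t+1}d)+q,$$ it holds for all $t=1,\dots,\nu-1$ that $\mathbf R_t\succeq0$ and $\ker\mathbf R_t\subseteq\ker\mathbf S_t^T\cap\ker g_t^T$. 3. There exist symmetric $P_t\in\mathbb R^{n\times n}$, vectors $\eta_t\in\mathbb R^n$ and numbers $\xi_t\in\mathbb R$ with $P_\nu=Q$, $\eta_\nu=q$ such that for all $t=1,\dots,\nu-1$ $$H_t:=\begin{bmatrix}\mathbf R_t&\mathbf S_t&g_t\\ \mathbf S_t^T&A^TP_{t+1}A+Q-P_t&\beta_t\\ g_t^T&\beta_t^T&\xi_t\end{bmatrix}\succeq0,\qquad \operatorname{rank}H_t=\operatorname{rank}\mathbf R_t,$$ where $\beta_t=q+A^TP_{t+1}d+A^T\eta_{t+1}-\eta_t$. 4. The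 Hamilton–Jacobi–Bellman equation $V_\nu(\chi)=\frac12\chi^TQ\chi+q^T\chi$, $$V_t(\chi)=\min_{\mu\in\mathbb R^m}\Big\{\tfrac12\chi^TQ\chi+q^T\chi+\tfrac12\mu^TR\mu+\mathbb E\big[V_{t+1}(A\chi+B\mu+d+w_t)\big]\Big\},\quad t=1,\dots,\nu-1,$$ has a finite solution $V_t:\mathbb R^n\to\mathbb R$, and it is given by $V_t(\chi)=\frac12\chi^TP_t\chi+\eta_t^T\chi+\gamma_t$ for $t=1,\dots,\nu$, with $P_t,\eta_t,\mathbf R_t,g_t$ as in 2, $\gamma_\nu=0$ and $$\gamma_t=\gamma_{t+1}-\tfrac12g_t^T\mathbf R_t^\dagger g_t+\tfrac12d^TP_{t+1}d+\eta_{t+1}^Td+\tfrac12\operatorname{tr}(P_{t+1}\Sigma_w).$$ Moreover, already if the equation in 4 with $\inf$ in place of $\min$ has a real-valued solution (that is, the expressions to be minimized are bounded from below), the infima are attained and the solution on $t=1,\dots,\nu$ is the quadratic one in 4. In addition, if any of the four statements holds, then for every $N\in\{2,\dots,\nu\}$ and every $x\in\mathbb R^n$ the optimal controls of the forward problem for $(N,x)$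 are given, with $P_t,\eta_t$ as in 2, by $$u_t=-\mathbf R_t^\dagger(\mathbf S_tx_t+g_t)+(I-\mathbf R_t^\dagger\mathbf R_t)\lambda_t,\quad t=\nu-N+1,\dots,\nu-1,\qquad u_t=0,\quad t=1,\dots,\nu-N,$$ with arbitrary $\lambda_t\in\mathbb R^m$: for all choices of constant vectors $\lambda_t$ this strategy is optimal, and an admissible strategy is optimal if and only if it has this form almost surely for some measurable functions $\lambda_t=\lambda_t(x_t)$. -/

import Mathlib

open MeasureTheory ProbabilityTheory Matrix

noncomputable section

namespace IndefLQ

/-! ### Moore-Penrose pseudo-inverse of a real matrix -/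

/-- `X` is a Moore-Penrose pseudo-inverse of the real matrix `M` (the four Penrose equations). -/
structure IsPseudoInverse {k l : Type*} [Fintype k] [Fintype l]
    (M : Matrix k l ℝ) (X : Matrix l k ℝ) : Prop where
  mul_mul_self : M * X * M = M
  self_mul_mul : X * M * X = X
  symm_left : (M * X)ᵀ = M * X
  symm_right : (X * M)ᵀ = X * M

theorem IsPseudoInverse.eq {k l : Type*} [Fintype k] [Fintype l]
    {M : Matrix k l ℝ} {X Y : Matrix l k ℝ}
    (hX : IsPseudoInverse M X) (hY : IsPseudoInverse M Y) : X = Y := by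
  have h1 : M * X = M * Y := by
    calc M * X = (M * Y * M) * X := by rw [hY.mul_mul_self]
      _ = (M * Y) * (M * X) := by simp only [Matrix.mul_assoc]
      _ = (M * Y)ᵀ * (M * X)ᵀ := by rw [hY.symm_left, hX.symm_left]
      _ = ((M * X * M) * Y)ᵀ := by rw [← Matrix.transpose_mul]; simp only [Matrix.mul_assoc]
      _ = M * Y := by rw [hX.mul_mul_self, hY.symm_left]
  have h2 : X * M = Y * M := by
    calc X * M = X * (M * Y * M) := by rw [hY.mul_mul_self]
      _ = (X * M) * (Y * M) := by simp only [Matrix.mul_assoc]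
      _ = (X * M)ᵀ * (Y * M)ᵀ := by rw [hX.symm_right, hY.symm_right]
      _ = (Y * (M * X * M))ᵀ := by rw [← Matrix.transpose_mul]; simp only [Matrix.mul_assoc]
      _ = Y * M := by rw [hX.mul_mul_self, hY.symm_right]
  calc X = X * M * X := hX.self_mul_mul.symm
    _ = Y * (M * X) := by rw [h2, Matrix.mul_assoc]
    _ = Y * M * Y := by rw [h1, Matrix.mul_assoc]
    _ = Y := hY.self_mul_mul

theorem exists_isPseudoInverse_of_isSymm {k : Type*} [Fintype k] [DecidableEq k]
    (G : Matrix k k ℝ) (hG : Gᵀ = G) : ∃ X, IsPseudoInverse G X := by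
  have hH : G.IsHermitian := by
    rw [Matrix.IsHermitian, Matrix.conjTranspose_eq_transpose_of_trivial, hG]
  set U : Matrix k k ℝ := (hH.eigenvectorUnitary : Matrix k k ℝ) with hU
  have hUU : Uᵀ * U = 1 := by
    have := Unitary.coe_star_mul_self hH.eigenvectorUnitary
    rwa [Matrix.star_eq_conjTranspose, Matrix.conjTranspose_eq_transpose_of_trivial] at this
  set a := hH.eigenvalues
  have hs : G = U * diagonal a * Uᵀ := by
    have := hH.spectral_theorem
    rw [Unitary.conjStarAlgAut_apply, Matrix.star_eq_conjTranspose,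
      Matrix.conjTranspose_eq_transpose_of_trivial] at this
    exact this
  have key : ∀ b c : k → ℝ, (U * diagonal b * Uᵀ) * (U * diagonal c * Uᵀ)
      = U * diagonal (fun i => b i * c i) * Uᵀ := by
    intro b c
    calc (U * diagonal b * Uᵀ) * (U * diagonal c * Uᵀ)
        = U * (diagonal b * (Uᵀ * U) * diagonal c) * Uᵀ := by simp only [Matrix.mul_assoc]
      _ = _ := by rw [hUU, Matrix.mul_one, diagonal_mul_diagonal]
  have ht : ∀ b : k → ℝ, (U * diagonal b * Uᵀ)ᵀ = U * diagonal b * Uᵀ := by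
    intro b
    simp only [transpose_mul, transpose_transpose, diagonal_transpose, Matrix.mul_assoc]
  refine ⟨U * diagonal (fun i => (a i)⁻¹) * Uᵀ, ?_, ?_, ?_, ?_⟩
  · rw [hs, key, key]
    congr 3
    funext i
    exact mul_inv_mul_cancel (a i)
  · rw [hs, key, key]
    congr 3
    funext i
    by_cases h : a i = 0
    · simp [h]
    · field_simp
  · rw [hs, key, ht]
  · rw [hs, key, ht]

theorem exists_isPseudoInverse {k l : Type*} [Fintype k] [Fintype l] (M : Matrix k l ℝ) :
    ∃ X, IsPseudoInverse M X := by
  classical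
  obtain ⟨Y, hY⟩ := exists_isPseudoInverse_of_isSymm (Mᵀ * M)
    (by rw [transpose_mul, transpose_transpose])
  have hYt : Yᵀ = Y := by
    refine IsPseudoInverse.eq (M := Mᵀ * M) ⟨?_, ?_, ?_, ?_⟩ hY
    · have := congrArg transpose hY.mul_mul_self
      simpa only [transpose_mul, transpose_transpose, Matrix.mul_assoc] using this
    · have := congrArg transpose hY.self_mul_mul
      simpa only [transpose_mul, transpose_transpose, Matrix.mul_assoc] using this
    · have := hY.symm_right
      simp only [transpose_mul, transpose_transpose, Matrix.mul_assoc] at this ⊢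
      exact this.symm
    · have := hY.symm_left
      simp only [transpose_mul, transpose_transpose, Matrix.mul_assoc] at this ⊢
      exact this.symm
  have hM : M * (Y * (Mᵀ * M)) = M := by
    rw [← sub_eq_zero, ← conjTranspose_mul_self_eq_zero,
      conjTranspose_eq_transpose_of_trivial]
    set Z := Y * (Mᵀ * M) with hZ
    have h1 : Mᵀ * M * Z = Mᵀ * M := by rw [hZ, ← Matrix.mul_assoc, hY.mul_mul_self]
    have h2 : Mᵀ * (M * Z - M) = 0 := by
      rw [Matrix.mul_sub, ← Matrix.mul_assoc, h1, sub_self]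
    rw [transpose_sub, transpose_mul, Matrix.sub_mul, Matrix.mul_assoc, h2, Matrix.mul_zero,
      sub_zero]
  refine ⟨Y * Mᵀ, ?_, ?_, ?_, ?_⟩
  · simpa only [Matrix.mul_assoc] using hM
  · have := hY.self_mul_mul
    calc Y * Mᵀ * M * (Y * Mᵀ) = (Y * (Mᵀ * M) * Y) * Mᵀ := by simp only [Matrix.mul_assoc]
      _ = Y * Mᵀ := by rw [this]
  · simp only [transpose_mul, transpose_transpose, hYt, Matrix.mul_assoc]
  · have := hY.symm_right
    simpa only [Matrix.mul_assoc] using this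

/-- The Moore-Penrose pseudo-inverse of a real matrix. -/
def pinv {k l : Type*} [Fintype k] [Fintype l] (M : Matrix k l ℝ) : Matrix l k ℝ :=
  Classical.choose (exists_isPseudoInverse M)

theorem isPseudoInverse_pinv {k l : Type*} [Fintype k] [Fintype l] (M : Matrix k l ℝ) :
    IsPseudoInverse M (pinv M) :=
  Classical.choose_spec (exists_isPseudoInverse M)

/-! ### Problem data -/

/-- The deterministic data of the linear-quadratic problem: the dynamics
`x_{t+1} = A x + B u + d + w` and the running cost `½ xᵀ Q x + qᵀ x + ½ uᵀ R u`, where `Q` and `R` are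
symmetric, with no sign assumption. -/
structure LQData (n m : ℕ) where
  A : Matrix (Fin n) (Fin n) ℝ
  B : Matrix (Fin n) (Fin m) ℝ
  Q : Matrix (Fin n) (Fin n) ℝ
  R : Matrix (Fin m) (Fin m) ℝ
  q : Fin n → ℝ
  d : Fin n → ℝ
  Q_symm : Q.IsSymm
  R_symm : R.IsSymm

/-! ### Standing assumptions on the random elements -/

/-- The sequence `z 1, z 2, …` consists of i.i.d. square integrable random vectors with mean zero
and covariance matrix `C`. -/
structure IsNoise {n : ℕ} {Ω : Type*} [MeasurableSpace Ω] (Pr : Measure Ω)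
    (z : ℕ → Ω → Fin n → ℝ) (C : Matrix (Fin n) (Fin n) ℝ) : Prop where
  measurable : ∀ t, 1 ≤ t → Measurable (z t)
  indep : iIndepFun (fun t : ℕ => z (t + 1)) Pr
  ident : ∀ t, 1 ≤ t → IdentDistrib (z t) (z 1) Pr Pr
  memLp : ∀ t, 1 ≤ t → ∀ i, MemLp (fun ω => z t ω i) 2 Pr
  mean : ∀ t, 1 ≤ t → ∀ i, ∫ ω, z t ω i ∂Pr = 0
  cov : ∀ t, 1 ≤ t → ∀ i j, cov[fun ω => z t ω i, fun ω => z t ω j; Pr] = C i j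
  posSemidef : C.PosSemidef

/-- The i.i.d. assumption: the three random elements `(xbar, N)`, `(w_t)_{t ≥ 1}` and
`(v_t)_{t ≥ 1}` are mutually independent, and `w` and `v` are centred i.i.d. sequences with
covariance matrices `Sw` and `Sv`. -/
structure IIDAssumption {n : ℕ} {Ω : Type*} [MeasurableSpace Ω] (Pr : Measure Ω)
    (xbar : Ω → Fin n → ℝ) (N : Ω → ℕ) (w v : ℕ → Ω → Fin n → ℝ)
    (Sw Sv : Matrix (Fin n) (Fin n) ℝ) : Prop where
  indep : iIndep (m := ![MeasurableSpace.comap (fun ω => (xbar ω, N ω)) inferInstance,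
    MeasurableSpace.comap (fun (ω : Ω) (t : ℕ) => w (t + 1) ω) inferInstance,
    MeasurableSpace.comap (fun (ω : Ω) (t : ℕ) => v (t + 1) ω) inferInstance]) Pr
  process_noise : IsNoise Pr w Sw
  observation_noise : IsNoise Pr v Sv

/-- The persistent excitation assumption: `𝔼‖xbar‖² < ∞`, and for each horizon length `N₀` of
positive probability and each `χ` there is `ρ > 0` such that each Euclidean ball around `ρ χ` has
positive probability under the conditional law of `xbar` given `N = N₀`. -/
structure PersistentExcitation {n : ℕ} {Ω : Type*} [MeasurableSpace Ω] (Pr : Measure Ω) (ν : ℕ)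
    (xbar : Ω → Fin n → ℝ) (N : Ω → ℕ) : Prop where
  sq_integrable : Integrable (fun ω => ‖WithLp.toLp 2 (xbar ω)‖ ^ 2) Pr
  excitation : ∀ N₀ ∈ Set.Icc 2 ν, 0 < Pr {ω | N ω = N₀} →
    ∀ χ : Fin n → ℝ, ∃ ρ : ℝ, 0 < ρ ∧ ∀ ε : ℝ, 0 < ε →
      0 < (ProbabilityTheory.cond Pr {ω | N ω = N₀})
        {ω | WithLp.toLp 2 (xbar ω) ∈ Metric.ball (WithLp.toLp 2 (ρ • χ)) ε}

namespace LQData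

variable {n m : ℕ} (D : LQData n m)

/-! ### The forward problem -/

/-- The part `½ xᵀ Q x + qᵀ x` of the running cost, which is also the terminal cost. -/
def stateCost (x : Fin n → ℝ) : ℝ := 1 / 2 * (x ⬝ᵥ D.Q *ᵥ x) + D.q ⬝ᵥ x

/-- The running cost `½ xᵀ Q x + qᵀ x + ½ uᵀ R u`. -/
def stageCost (x : Fin n → ℝ) (u : Fin m → ℝ) : ℝ :=
  D.stateCost x + 1 / 2 * (u ⬝ᵥ D.R *ᵥ u)

/-- The state process `x_t` under the feedback strategy `u_t = μ_t(x_t)`: it stands still at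
`x` for times `1, …, ν - N + 1`, and then follows `x_{t+1} = A x_t + B μ_t(x_t) + d + w_t`.
The value at time `0` is a dummy, equal to the value at time `1`. -/
def state {Ω : Type*} (w : ℕ → Ω → Fin n → ℝ) (ν N : ℕ) (x : Fin n → ℝ)
    (μ : ℕ → (Fin n → ℝ) → (Fin m → ℝ)) : ℕ → Ω → Fin n → ℝ
  | 0, _ => x
  | t + 1, ω =>
    if t ≤ ν - N then state w ν N x μ t ω
    else D.A *ᵥ state w ν N x μ t ω + D.B *ᵥ μ t (state w ν N x μ t ω) + D.d + w t ω

variable {Ω : Type*} [MeasurableSpace Ω] (Pr : Measure Ω) (w : ℕ → Ω → Fin n → ℝ)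

/-- The cost `J_N` of a strategy, for planning horizon `N` and initial value `x`. -/
def cost (ν N : ℕ) (x : Fin n → ℝ) (μ : ℕ → (Fin n → ℝ) → (Fin m → ℝ)) : ℝ :=
  ∫ ω, (D.stateCost (D.state w ν N x μ ν ω)
    + ∑ t ∈ Finset.Icc (ν - N + 1) (ν - 1),
        D.stageCost (D.state w ν N x μ t ω) (μ t (D.state w ν N x μ t ω))) ∂Pr

/-- Admissible strategies: measurable state feedbacks `μ_t : ℝⁿ → ℝᵐ`, zero before the start of
the planning horizon, with square integrable control signals `u_t = μ_t(x_t)`, so that the expected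
cost is well defined. -/
structure Admissible (ν N : ℕ) (x : Fin n → ℝ) (μ : ℕ → (Fin n → ℝ) → (Fin m → ℝ)) : Prop where
  measurable : ∀ t ∈ Set.Icc 1 (ν - 1), Measurable (μ t)
  stand_still : ∀ t ∈ Set.Icc 1 (ν - N), ∀ χ, μ t χ = 0
  sq_integrable : ∀ t ∈ Set.Icc (ν - N + 1) (ν - 1),
    Integrable (fun ω => μ t (D.state w ν N x μ t ω) ⬝ᵥ μ t (D.state w ν N x μ t ω)) Pr

/-- `μ` solves the forward problem with planning horizon `N` and initial value `x`. -/
def IsOptimal (ν N : ℕ) (x : Fin n → ℝ) (μ : ℕ → (Fin n → ℝ) → (Fin m → ℝ)) : Prop :=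
  D.Admissible Pr w ν N x μ ∧
    ∀ μ', D.Admissible Pr w ν N x μ' → D.cost Pr w ν N x μ ≤ D.cost Pr w ν N x μ'

/-- The forward problem admits solutions for all `N ∈ {2, …, ν}`, almost surely under the
distribution of `xbar`. -/
def ForwardSolvable (ν : ℕ) (xbar : Ω → Fin n → ℝ) : Prop :=
  ∀ N ∈ Set.Icc 2 ν, ∀ᵐ x ∂(Pr.map xbar), ∃ μ, D.IsOptimal Pr w ν N x μ

/-! ### Riccati recursions -/

/-- `S = Bᵀ Pn A`, where `Pn` is the matrix at the next time step. -/
def S (Pn : Matrix (Fin n) (Fin n) ℝ) : Matrix (Fin m) (Fin n) ℝ := D.Bᵀ * Pn * D.A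

/-- `𝐑 = Bᵀ Pn B + R`, where `Pn` is the matrix at the next time step. -/
def Rr (Pn : Matrix (Fin n) (Fin n) ℝ) : Matrix (Fin m) (Fin m) ℝ := D.Bᵀ * Pn * D.B + D.R

/-- `g = Bᵀ ηn + Bᵀ Pn d`, where `Pn`, `ηn` are taken at the next time step. -/
def g (Pn : Matrix (Fin n) (Fin n) ℝ) (ηn : Fin n → ℝ) : Fin m → ℝ :=
  D.Bᵀ *ᵥ ηn + (D.Bᵀ * Pn) *ᵥ D.d

/-- `ricP s` is `P_{ν-s}`, that is, the Riccati matrix with `s` steps to go. -/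
def ricP : ℕ → Matrix (Fin n) (Fin n) ℝ
  | 0 => D.Q
  | s + 1 => D.Aᵀ * ricP s * D.A + D.Q
      - D.Aᵀ * ricP s * D.B * pinv (D.Bᵀ * ricP s * D.B + D.R) * D.Bᵀ * ricP s * D.A

/-- `ricη s` is `η_{ν-s}`. -/
def ricη : ℕ → Fin n → ℝ
  | 0 => D.q
  | s + 1 => (D.A - D.B * pinv (D.Bᵀ * D.ricP s * D.B + D.R) * D.Bᵀ * D.ricP s * D.A)ᵀ
      *ᵥ (ricη s + D.ricP s *ᵥ D.d) + D.q

/-- `ricγ s` is `γ_{ν-s}`. -/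
def ricγ (Sw : Matrix (Fin n) (Fin n) ℝ) : ℕ → ℝ
  | 0 => 0
  | s + 1 => ricγ Sw s
      - 1 / 2 * (D.g (D.ricP s) (D.ricη s) ⬝ᵥ
          pinv (D.Rr (D.ricP s)) *ᵥ D.g (D.ricP s) (D.ricη s))
      + 1 / 2 * (D.d ⬝ᵥ D.ricP s *ᵥ D.d) + D.ricη s ⬝ᵥ D.d
      + 1 / 2 * (D.ricP s * Sw).trace

/-- The matrix `P_t`, for `t = 1, …, ν`, of the Riccati recursion with `P_ν = Q`. -/
def P (ν t : ℕ) : Matrix (Fin n) (Fin n) ℝ := D.ricP (ν - t)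

/-- The vector `η_t`, for `t = 1, …, ν`, with `η_ν = q`. -/
def η (ν t : ℕ) : Fin n → ℝ := D.ricη (ν - t)

/-- The constant `γ_t`, for `t = 1, …, ν`, with `γ_ν = 0`. -/
def γ (Sw : Matrix (Fin n) (Fin n) ℝ) (ν t : ℕ) : ℝ := D.ricγ Sw (ν - t)

/-- For all `t = 1, …, ν - 1`: `𝐑_t ⪰ 0` and `ker 𝐑_t ⊆ ker S_tᵀ ∩ ker g_tᵀ`, along the Riccati
recursions. -/
def RiccatiCondition (ν : ℕ) : Prop :=
  ∀ t ∈ Set.Icc 1 (ν - 1),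
    (D.Rr (D.P ν (t + 1))).PosSemidef ∧
    ∀ z : Fin m → ℝ, D.Rr (D.P ν (t + 1)) *ᵥ z = 0 →
      (D.S (D.P ν (t + 1)))ᵀ *ᵥ z = 0 ∧ D.g (D.P ν (t + 1)) (D.η ν (t + 1)) ⬝ᵥ z = 0

/-! ### The linear matrix inequality with rank condition -/

/-- The block matrix `H_t`, built from `P_t`, `P_{t+1}`, `η_t`, `η_{t+1}`, `ξ_t`. -/
def H (P Pn : Matrix (Fin n) (Fin n) ℝ) (η ηn : Fin n → ℝ) (ξ : ℝ) :
    Matrix (Fin m ⊕ (Fin n ⊕ Unit)) (Fin m ⊕ (Fin n ⊕ Unit)) ℝ :=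
  let β : Fin n → ℝ := D.q + (D.Aᵀ * Pn) *ᵥ D.d + D.Aᵀ *ᵥ ηn - η
  fromBlocks
    (D.Rr Pn) (fromCols (D.S Pn) (replicateCol Unit (D.g Pn ηn)))
    (fromRows (D.S Pn)ᵀ (replicateRow Unit (D.g Pn ηn)))
    (fromBlocks (D.Aᵀ * Pn * D.A + D.Q - P) (replicateCol Unit β)
      (replicateRow Unit β) (Matrix.of fun _ _ => ξ))

/-- There are symmetric `P_t`, vectors `η_t` and numbers `ξ_t` with `P_ν = Q`, `η_ν = q`, such that
`H_t ⪰ 0` and `rank H_t = rank 𝐑_t` for `t = 1, …, ν - 1`. -/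
def LMICondition (ν : ℕ) : Prop :=
  ∃ (P : ℕ → Matrix (Fin n) (Fin n) ℝ) (η : ℕ → Fin n → ℝ) (ξ : ℕ → ℝ),
    (∀ t ∈ Set.Icc 1 ν, (P t).IsSymm) ∧ P ν = D.Q ∧ η ν = D.q ∧
    ∀ t ∈ Set.Icc 1 (ν - 1),
      (D.H (P t) (P (t + 1)) (η t) (η (t + 1)) (ξ t)).PosSemidef ∧
      (D.H (P t) (P (t + 1)) (η t) (η (t + 1)) (ξ t)).rank = (D.Rr (P (t + 1))).rank

/-! ### The Hamilton-Jacobi-Bellman equation -/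

/-- The expression which is minimized over `u` in the HJB equation at time `t` and state `χ`. -/
def bellman (V : ℕ → (Fin n → ℝ) → ℝ) (t : ℕ) (χ : Fin n → ℝ) (u : Fin m → ℝ) : ℝ :=
  D.stageCost χ u + ∫ ω, V (t + 1) (D.A *ᵥ χ + D.B *ᵥ u + D.d + w t ω) ∂Pr

/-- `V` has the terminal value of the HJB equation and the expectations in it exist. -/
structure IsValueCandidate (ν : ℕ) (V : ℕ → (Fin n → ℝ) → ℝ) : Prop where
  terminal : ∀ χ, V ν χ = D.stateCost χ
  integrable : ∀ t ∈ Set.Icc 1 (ν - 1), ∀ χ u,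
    Integrable (fun ω => V (t + 1) (D.A *ᵥ χ + D.B *ᵥ u + D.d + w t ω)) Pr

/-- `V` solves the HJB equation in the weak sense, with an infimum: for all `t` and `χ` the
expression to be minimized is bounded from below, and `V_t(χ)` is its infimum. -/
def SolvesHJBInf (ν : ℕ) (V : ℕ → (Fin n → ℝ) → ℝ) : Prop :=
  D.IsValueCandidate Pr w ν V ∧
    ∀ t ∈ Set.Icc 1 (ν - 1), ∀ χ, IsGLB (Set.range (D.bellman Pr w V t χ)) (V t χ)

/-- `V` solves the HJB equation, with an attained minimum. -/
def SolvesHJB (ν : ℕ) (V : ℕ → (Fin n → ℝ) → ℝ) : Prop :=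
  D.IsValueCandidate Pr w ν V ∧
    ∀ t ∈ Set.Icc 1 (ν - 1), ∀ χ, IsLeast (Set.range (D.bellman Pr w V t χ)) (V t χ)

/-- `V_t(χ) = ½ χᵀ P_t χ + η_tᵀ χ + γ_t` for `t = 1, …, ν`. -/
def IsQuadraticValue (Sw : Matrix (Fin n) (Fin n) ℝ) (ν : ℕ) (V : ℕ → (Fin n → ℝ) → ℝ) : Prop :=
  ∀ t ∈ Set.Icc 1 ν, ∀ χ : Fin n → ℝ,
    V t χ = 1 / 2 * (χ ⬝ᵥ D.P ν t *ᵥ χ) + D.η ν t ⬝ᵥ χ + D.γ Sw ν t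

/-! ### The optimal controls -/

/-- The control `-𝐑_t† (S_t χ + g_t) + (I - 𝐑_t† 𝐑_t) l` at time `t` in the state `χ`. -/
def control (ν t : ℕ) (χ : Fin n → ℝ) (l : Fin m → ℝ) : Fin m → ℝ :=
  -(pinv (D.Rr (D.P ν (t + 1))) *ᵥ
      (D.S (D.P ν (t + 1)) *ᵥ χ + D.g (D.P ν (t + 1)) (D.η ν (t + 1))))
    + (1 - pinv (D.Rr (D.P ν (t + 1))) * D.Rr (D.P ν (t + 1))) *ᵥ l

/-- The strategy that applies no control for `t = 1, …, ν - N`, and from then on `control` with the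
kernel parameter `l t`. -/
def strategy (ν N : ℕ) (l : ℕ → Fin m → ℝ) (t : ℕ) (χ : Fin n → ℝ) : Fin m → ℝ :=
  if t ≤ ν - N then 0 else D.control ν t χ (l t)

end LQData

end IndefLQ

end

/-! The proof is backward dynamic programming with quadratic value functions. If `V_{t+1}` is the
quadratic with data `P_{t+1}`, `η_{t+1}`, then the expression to be minimized at time `t` is a
quadratic polynomial in `u` with Hessian `𝐑_t` and linear term `S_t x + g_t`; centred noise
independent of the state adds only the constant `½ tr(P_{t+1} Σ_w)`. Such a polynomial is bounded
from below only if `𝐑_t ⪰ 0` and its linear term annihilates `ker 𝐑_t` (`bounded_quadratic`). Asking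
this for enough `x` gives statement 2 at time `t` (`stepCondition_of_bounded`).

Conversely, under this condition completing the square (`stageCost_add_quad_eq`) writes the
expression as `V_t(x)` plus the excess `½ (u - û)ᵀ 𝐑_t (u - û)`, where `û = -𝐑_t†(S_t x + g_t)`.
This solves the Bellman equation. Summed over time, it shows that the cost of any admissible
strategy is the value at the initial state plus the expected excesses, so the optimal strategies are
those with almost surely vanishing excess.

For 1 → 2, horizon `N` tests time `ν - N + 1`: once the condition holds at all later times, an
arbitrary first control followed by the preferred feedback costs a quadratic polynomial in that
control, bounded from below by the optimal cost. This is known only for almost every initial state;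
persistent excitation and continuity extend the kernel condition to all states.

For 2 ↔ 3, rank equality says that the Schur complement of `𝐑_t` in `H_t` vanishes, and its blocks
are the Riccati recursions. -/

namespace IndefLQ

/-! ### Pseudo-inverses of symmetric matrices -/

section PseudoInverse

variable {k l : Type*} [Fintype k]

theorem pinv_transpose (M : Matrix k k ℝ) (hM : Mᵀ = M) : (pinv M)ᵀ = pinv M := by
  have h := isPseudoInverse_pinv M
  refine IsPseudoInverse.eq (M := M) ⟨?_, ?_, ?_, ?_⟩ h
  · have := congrArg transpose h.mul_mul_self
    simpa only [transpose_mul, hM, Matrix.mul_assoc] using this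
  · have := congrArg transpose h.self_mul_mul
    simpa only [transpose_mul, hM, Matrix.mul_assoc] using this
  · have := h.symm_right
    simp only [transpose_mul, transpose_transpose, hM] at this ⊢
    exact this.symm
  · have := h.symm_left
    simp only [transpose_mul, transpose_transpose, hM] at this ⊢
    exact this.symm

/-- For symmetric `M`, `M * pinv M` is the orthogonal projection onto the range of `M`, which is the
orthogonal complement of `ker M`. The hypothesis puts the columns of `X` there. -/
theorem mul_pinv_mul_of_ker (M : Matrix k k ℝ) (hM : Mᵀ = M) (X : Matrix k l ℝ)
    (hX : ∀ z, M *ᵥ z = 0 → Xᵀ *ᵥ z = 0) : M * pinv M * X = X := by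
  classical
  have h := isPseudoInverse_pinv M
  have h1 : Xᵀ * (1 - pinv M * M) = 0 := by
    apply Matrix.ext_of_mulVec_single
    intro i
    rw [← mulVec_mulVec, hX, Matrix.zero_mulVec]
    rw [mulVec_mulVec, Matrix.mul_sub, ← Matrix.mul_assoc, h.mul_mul_self, Matrix.mul_one,
      sub_self, Matrix.zero_mulVec]
  have h2 := congrArg transpose h1
  rw [transpose_mul, transpose_sub, transpose_mul, pinv_transpose M hM, hM, transpose_one,
    transpose_transpose, Matrix.sub_mul, Matrix.one_mul, transpose_zero, sub_eq_zero] at h2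
  exact h2.symm

theorem mul_pinv_mulVec_of_ker (M : Matrix k k ℝ) (hM : Mᵀ = M) (x : k → ℝ)
    (hx : ∀ z, M *ᵥ z = 0 → x ⬝ᵥ z = 0) : M *ᵥ pinv M *ᵥ x = x := by
  have h := mul_pinv_mul_of_ker M hM (replicateCol Unit x) (fun z hz => by
    ext i
    simpa [mulVec, dotProduct] using hx z hz)
  ext i
  have := congrFun (congrFun h i) ()
  rw [mulVec_mulVec]
  simpa [Matrix.mul_apply, mulVec, dotProduct] using this

end PseudoInverse

/-! ### Schur complements and rank of block matrices -/

section BlockRank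

variable {k l : Type*} [Fintype k] [Fintype l] [DecidableEq k]

theorem rank_le_rank_fromBlocks (M : Matrix k k ℝ) (X : Matrix k l ℝ) (Z : Matrix l k ℝ)
    (Y : Matrix l l ℝ) : M.rank ≤ (fromBlocks M X Z Y).rank := by
  have : M = fromCols (1 : Matrix k k ℝ) (0 : Matrix k l ℝ) *
      (fromBlocks M X Z Y * fromRows (1 : Matrix k k ℝ) (0 : Matrix l k ℝ)) := by
    rw [fromBlocks_mul_fromRows, fromCols_mul_fromRows]
    simp
  conv_lhs => rw [this]
  exact (rank_mul_le_right _ _).trans (rank_mul_le_left _ _)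

/-- The block matrix is `Wᵀ * M * W` with `W = [1, pinv M * X]`, hence semidefinite and of rank at
most that of `M`. The corner `M` gives the reverse inequality. -/
theorem fromBlocks_posSemidef_rank (M : Matrix k k ℝ) (hM : M.PosSemidef) (X : Matrix k l ℝ)
    (hX : ∀ z, M *ᵥ z = 0 → Xᵀ *ᵥ z = 0) :
    (fromBlocks M X Xᵀ (Xᵀ * pinv M * X)).PosSemidef ∧
      (fromBlocks M X Xᵀ (Xᵀ * pinv M * X)).rank = M.rank := by
  have hMt : Mᵀ = M := by
    have := hM.1
    rwa [Matrix.IsHermitian, conjTranspose_eq_transpose_of_trivial] at this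
  have hX1 := mul_pinv_mul_of_ker M hMt X hX
  set W : Matrix k (k ⊕ l) ℝ := fromCols 1 (pinv M * X)
  have hX2 : Xᵀ * pinv M * M = Xᵀ := by
    have := congrArg transpose hX1
    simpa only [transpose_mul, hMt, pinv_transpose M hMt, Matrix.mul_assoc] using this
  have hW : fromBlocks M X Xᵀ (Xᵀ * pinv M * X) = Wᵀ * M * W := by
    rw [transpose_fromCols, transpose_one, transpose_mul, pinv_transpose M hMt,
      fromRows_mul, fromRows_mul_fromCols]
    simp only [Matrix.one_mul, Matrix.mul_one]
    rw [hX2, ← Matrix.mul_assoc, hX1, ← Matrix.mul_assoc]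
  constructor
  · rw [hW, ← conjTranspose_eq_transpose_of_trivial]
    exact hM.conjTranspose_mul_mul_same W
  · refine le_antisymm ?_ (rank_le_rank_fromBlocks _ _ _ _)
    rw [hW]
    exact (rank_mul_le_left _ _).trans (rank_mul_le_right _ _)

variable [DecidableEq l]

/-- The first block column has rank at least `M.rank`, which is the rank of the whole matrix, so its
range is the whole range. The remaining columns are therefore combinations of it, with coefficients
`K`. -/
theorem exists_factor_of_rank_fromBlocks (M : Matrix k k ℝ) (X : Matrix k l ℝ) (Z : Matrix l k ℝ)
    (Y : Matrix l l ℝ) (h : (fromBlocks M X Z Y).rank = M.rank) :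
    ∃ K : Matrix k l ℝ, X = M * K ∧ Y = Z * K := by
  set H := fromBlocks M X Z Y
  have hle : LinearMap.range (fromRows M Z).mulVecLin ≤ LinearMap.range H.mulVecLin := by
    have : fromRows M Z = H * fromRows (1 : Matrix k k ℝ) (0 : Matrix l k ℝ) := by
      rw [fromBlocks_mul_fromRows]; simp
    rw [this, mulVecLin_mul]
    exact LinearMap.range_comp_le_range _ _
  have hM : M.rank ≤ (fromRows M Z).rank := by
    have : M = fromCols (1 : Matrix k k ℝ) (0 : Matrix k l ℝ) * fromRows M Z := by
      rw [fromCols_mul_fromRows]; simp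
    conv_lhs => rw [this]
    exact rank_mul_le_right _ _
  have heq := Submodule.eq_of_le_of_finrank_le hle (by
    change H.rank ≤ (fromRows M Z).rank
    rw [h]; exact hM)
  have key : ∀ j : l, ∃ c : k → ℝ, fromRows M Z *ᵥ c = fun i => H i (Sum.inr j) := by
    intro j
    have : H.mulVecLin (Pi.single (Sum.inr j) 1) ∈ LinearMap.range (fromRows M Z).mulVecLin := by
      rw [heq]; exact LinearMap.mem_range_self _ _
    obtain ⟨c, hc⟩ := this
    refine ⟨c, ?_⟩
    rw [mulVecLin_apply, mulVecLin_apply] at hc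
    rw [hc]
    ext i
    simp
  choose c hc using key
  refine ⟨Matrix.of fun i j => c j i, ?_, ?_⟩
  · ext i j
    have := congrFun (hc j) (Sum.inl i)
    simpa [mulVec, dotProduct, Matrix.mul_apply, H] using this.symm
  · ext i j
    have := congrFun (hc j) (Sum.inr i)
    simpa [mulVec, dotProduct, Matrix.mul_apply, H] using this.symm

theorem schur_eq_of_rank_fromBlocks (M : Matrix k k ℝ) (hM : Mᵀ = M) (X : Matrix k l ℝ)
    (Y : Matrix l l ℝ) (h : (fromBlocks M X Xᵀ Y).rank = M.rank) :
    Y = Xᵀ * pinv M * X ∧ ∀ z, M *ᵥ z = 0 → Xᵀ *ᵥ z = 0 := by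
  obtain ⟨K, hX, hY⟩ := exists_factor_of_rank_fromBlocks M X Xᵀ Y h
  have hXt : Xᵀ = Kᵀ * M := by rw [hX, transpose_mul, hM]
  constructor
  · have := (isPseudoInverse_pinv M).mul_mul_self
    calc Y = Kᵀ * (M * pinv M * M) * K := by rw [this, hY, hXt]
      _ = Xᵀ * pinv M * X := by rw [hXt, hX]; simp only [Matrix.mul_assoc]
  · intro z hz
    rw [hXt, ← mulVec_mulVec, hz, mulVec_zero]

end BlockRank

/-! ### Quadratic polynomials bounded from below -/

section BoundedQuadratic

theorem bounded_quadratic_line {a b c : ℝ} (h : ∀ s : ℝ, c ≤ a * s ^ 2 + b * s) :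
    0 ≤ a ∧ (a = 0 → b = 0) := by
  have hlin : ∀ b c : ℝ, (∀ s : ℝ, c ≤ b * s) → b = 0 := by
    intro b c h
    by_contra hb
    have := h ((c - 1) / b)
    rw [mul_div_cancel₀ _ hb] at this
    linarith
  refine ⟨?_, fun ha => hlin b c fun s => by simpa [ha] using h s⟩
  by_contra! ha
  have h2 : ∀ s : ℝ, c ≤ a * s ^ 2 := fun s => by
    -- Averaging over `s` and `-s` removes the linear term.
    have h1 := h s
    have h3 := h (-s)
    nlinarith
  -- As `c ≤ a < 0`, the ratio `c / a` is positive, and at this point the parabola equals `a + 2 * c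
  -- + c * (c / a) < c`.
  have h3 := h2 (1 + c / a)
  have h4 := h2 1
  have hc : c < 0 := by linarith
  have hr : 0 < c / a := div_pos_of_neg_of_neg hc ha
  have e : a * (1 + c / a) ^ 2 = a + 2 * c + c * (c / a) := by
    linear_combination (2 + c / a) * mul_div_cancel₀ c ha.ne
  nlinarith [mul_neg_of_neg_of_pos hc hr]

/-- Restriction to each line through the origin reduces this to one variable. -/
theorem bounded_quadratic {k : Type*} [Fintype k] (M : Matrix k k ℝ) (hM : Mᵀ = M) (h : k → ℝ)
    (b : ℝ) (hb : ∀ u : k → ℝ, b ≤ 1 / 2 * (u ⬝ᵥ M *ᵥ u) + u ⬝ᵥ h) :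
    M.PosSemidef ∧ ∀ z, M *ᵥ z = 0 → h ⬝ᵥ z = 0 := by
  have key : ∀ z : k → ℝ, 0 ≤ 1 / 2 * (z ⬝ᵥ M *ᵥ z) ∧
      (1 / 2 * (z ⬝ᵥ M *ᵥ z) = 0 → z ⬝ᵥ h = 0) := by
    intro z
    refine bounded_quadratic_line (c := b) fun s => ?_
    have := hb (s • z)
    simp only [mulVec_smul, smul_dotProduct, dotProduct_smul, smul_eq_mul] at this
    linarith
  constructor
  · refine PosSemidef.of_dotProduct_mulVec_nonneg ?_ fun z => ?_
    · rwa [Matrix.IsHermitian, conjTranspose_eq_transpose_of_trivial]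
    · have := (key z).1
      simp only [star_trivial]
      linarith
  · intro z hz
    rw [dotProduct_comm]
    exact (key z).2 (by simp [hz])

end BoundedQuadratic

/-- The quadratic polynomial `½ xᵀ P x + ηᵀ x + c`. -/
noncomputable def quad {n : ℕ} (P : Matrix (Fin n) (Fin n) ℝ) (η : Fin n → ℝ) (c : ℝ)
    (x : Fin n → ℝ) : ℝ :=
  1 / 2 * (x ⬝ᵥ P *ᵥ x) + η ⬝ᵥ x + c

theorem mulVec_dotProduct {k l : Type*} [Fintype k] [Fintype l] (M : Matrix k l ℝ)
    (x : l → ℝ) (y : k → ℝ) : M *ᵥ x ⬝ᵥ y = x ⬝ᵥ Mᵀ *ᵥ y := by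
  rw [dotProduct_comm, dotProduct_mulVec, dotProduct_comm, mulVec_transpose]

theorem quad_add {n : ℕ} (P : Matrix (Fin n) (Fin n) ℝ) (hP : Pᵀ = P) (η : Fin n → ℝ) (c : ℝ)
    (x y : Fin n → ℝ) :
    quad P η c (x + y) = quad P η c x + (P *ᵥ x + η) ⬝ᵥ y + 1 / 2 * (y ⬝ᵥ P *ᵥ y) := by
  have h1 : P *ᵥ x ⬝ᵥ y = x ⬝ᵥ P *ᵥ y := by rw [mulVec_dotProduct, hP]
  have h2 : y ⬝ᵥ P *ᵥ x = x ⬝ᵥ P *ᵥ y := by rw [dotProduct_comm, h1]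
  simp only [quad, mulVec_add, dotProduct_add, add_dotProduct, h1, h2]
  ring

/-! ### One step of the recursion: completing the square -/

namespace LQData

variable {n m : ℕ} (D : LQData n m)

/-- The condition `𝐑 ⪰ 0` and `ker 𝐑 ⊆ ker Sᵀ ∩ ker gᵀ` at a single time, where `Pn`, `ηn` are
taken at the next time step. -/
def StepCondition (Pn : Matrix (Fin n) (Fin n) ℝ) (ηn : Fin n → ℝ) : Prop :=
  (D.Rr Pn).PosSemidef ∧
    ∀ z : Fin m → ℝ, D.Rr Pn *ᵥ z = 0 → (D.S Pn)ᵀ *ᵥ z = 0 ∧ D.g Pn ηn ⬝ᵥ z = 0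

/-- The preferred control `-𝐑† (S x + g)`. -/
noncomputable def nominal (Pn : Matrix (Fin n) (Fin n) ℝ) (ηn : Fin n → ℝ)
    (x : Fin n → ℝ) : Fin m → ℝ :=
  -(pinv (D.Rr Pn) *ᵥ (D.S Pn *ᵥ x + D.g Pn ηn))

/-- The excess cost `½ (u - û)ᵀ 𝐑 (u - û)` over the preferred control `û`. -/
noncomputable def excess (Pn : Matrix (Fin n) (Fin n) ℝ) (ηn : Fin n → ℝ)
    (x : Fin n → ℝ) (u : Fin m → ℝ) : ℝ :=
  1 / 2 * ((u - D.nominal Pn ηn x) ⬝ᵥ D.Rr Pn *ᵥ (u - D.nominal Pn ηn x))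

theorem Rr_transpose (Pn : Matrix (Fin n) (Fin n) ℝ) (hP : Pnᵀ = Pn) :
    (D.Rr Pn)ᵀ = D.Rr Pn := by
  have := D.R_symm.eq
  simp only [Rr, transpose_add, transpose_mul, transpose_transpose, hP, this, Matrix.mul_assoc]

theorem ricP_transpose (s : ℕ) : (D.ricP s)ᵀ = D.ricP s := by
  induction s with
  | zero => exact D.Q_symm
  | succ s ih =>
    have h := pinv_transpose _ (D.Rr_transpose _ ih)
    have hQ := D.Q_symm.eq
    simp only [Rr] at h
    simp only [ricP, transpose_sub, transpose_add, transpose_mul, transpose_transpose, ih, hQ, h]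
    simp only [Matrix.mul_assoc]

theorem P_transpose (ν t : ℕ) : (D.P ν t)ᵀ = D.P ν t := D.ricP_transpose _

/-- The state-dependent part of the expression minimized in one step. -/
theorem stageCost_add_quad (Pn : Matrix (Fin n) (Fin n) ℝ) (hP : Pnᵀ = Pn) (ηn : Fin n → ℝ)
    (c : ℝ) (x : Fin n → ℝ) (u : Fin m → ℝ) :
    D.stageCost x u + quad Pn ηn c (D.A *ᵥ x + D.B *ᵥ u + D.d) =
      (1 / 2 * (u ⬝ᵥ D.Rr Pn *ᵥ u) + u ⬝ᵥ (D.S Pn *ᵥ x + D.g Pn ηn)) +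
      quad (D.Aᵀ * Pn * D.A + D.Q) (D.Aᵀ *ᵥ (ηn + Pn *ᵥ D.d) + D.q)
        (1 / 2 * (D.d ⬝ᵥ Pn *ᵥ D.d) + ηn ⬝ᵥ D.d + c) x := by
  have e1 : ∀ y z : Fin n → ℝ, y ⬝ᵥ Pn *ᵥ z = z ⬝ᵥ Pn *ᵥ y := fun y z => by
    rw [dotProduct_comm, mulVec_dotProduct, hP]
  simp only [stageCost, stateCost, quad, Rr, S, g, mulVec_add, add_mulVec, dotProduct_add,
    add_dotProduct, ← mulVec_mulVec, ← mulVec_dotProduct]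
  rw [e1 (D.A *ᵥ x) (D.B *ᵥ u), e1 D.d (D.B *ᵥ u), e1 D.d (D.A *ᵥ x)]
  have e2 : ∀ y : Fin n → ℝ, D.Aᵀ *ᵥ y ⬝ᵥ x = D.A *ᵥ x ⬝ᵥ y := fun y => by
    rw [mulVec_dotProduct, transpose_transpose, dotProduct_comm]
  rw [e2, e2, dotProduct_comm ηn (D.A *ᵥ x), dotProduct_comm ηn (D.B *ᵥ u)]
  ring

/-- The kernel condition puts the linear term in the range of `𝐑`, so the preferred control is an
exact stationary point: `𝐑 û + S x + g = 0`. -/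
theorem StepCondition.range {D : LQData n m} {Pn : Matrix (Fin n) (Fin n) ℝ} {ηn : Fin n → ℝ}
    (hP : Pnᵀ = Pn) (h : D.StepCondition Pn ηn) (x : Fin n → ℝ) :
    D.Rr Pn *ᵥ pinv (D.Rr Pn) *ᵥ (D.S Pn *ᵥ x + D.g Pn ηn) = D.S Pn *ᵥ x + D.g Pn ηn := by
  refine mul_pinv_mulVec_of_ker _ (D.Rr_transpose Pn hP) _ fun z hz => ?_
  obtain ⟨h1, h2⟩ := h.2 z hz
  rw [add_dotProduct, mulVec_dotProduct, h1, h2, dotProduct_zero, add_zero]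

theorem ricP_succ (s : ℕ) : D.ricP (s + 1) = D.Aᵀ * D.ricP s * D.A + D.Q -
    (D.S (D.ricP s))ᵀ * pinv (D.Rr (D.ricP s)) * D.S (D.ricP s) := by
  change _ - D.Aᵀ * D.ricP s * D.B * pinv (D.Rr (D.ricP s)) * D.Bᵀ * D.ricP s * D.A = _
  simp only [S, transpose_mul, transpose_transpose, D.ricP_transpose s, Matrix.mul_assoc]

theorem ricη_succ (s : ℕ) : D.ricη (s + 1) = D.Aᵀ *ᵥ (D.ricη s + D.ricP s *ᵥ D.d) + D.q -
    (D.S (D.ricP s))ᵀ *ᵥ pinv (D.Rr (D.ricP s)) *ᵥ D.g (D.ricP s) (D.ricη s) := by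
  have hP := D.ricP_transpose s
  have hXT := pinv_transpose _ (D.Rr_transpose _ hP)
  change (D.A - D.B * pinv (D.Rr (D.ricP s)) * D.Bᵀ * D.ricP s * D.A)ᵀ *ᵥ
    (D.ricη s + D.ricP s *ᵥ D.d) + D.q = _
  simp only [S, g, transpose_mul, transpose_transpose, transpose_sub, hP, hXT, Matrix.mul_assoc,
    sub_mulVec, mulVec_add, ← mulVec_mulVec]
  abel

/-- The square is completed around `û`. The quadratic is evaluated at the successor state without
noise; the effect of the noise is the trace term in its constant. -/
theorem stageCost_add_quad_eq (Sw : Matrix (Fin n) (Fin n) ℝ) (s : ℕ)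
    (h : D.StepCondition (D.ricP s) (D.ricη s)) (x : Fin n → ℝ) (u : Fin m → ℝ) :
    D.stageCost x u + quad (D.ricP s) (D.ricη s)
        (D.ricγ Sw s + 1 / 2 * (D.ricP s * Sw).trace) (D.A *ᵥ x + D.B *ᵥ u + D.d) =
      quad (D.ricP (s + 1)) (D.ricη (s + 1)) (D.ricγ Sw (s + 1)) x +
        D.excess (D.ricP s) (D.ricη s) x u := by
  have hP := D.ricP_transpose s
  rw [stageCost_add_quad _ _ hP]
  have hr := h.range hP x
  have hrT := D.Rr_transpose _ hP
  have hXT := pinv_transpose _ hrT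
  set Pn := D.ricP s with hPn
  set ηn := D.ricη s with hηn
  set X := pinv (D.Rr Pn) with hX
  set y := D.S Pn *ᵥ x + D.g Pn ηn with hy
  have e1 : D.excess Pn ηn x u = 1 / 2 * (u ⬝ᵥ D.Rr Pn *ᵥ u) + u ⬝ᵥ y + 1 / 2 * (y ⬝ᵥ X *ᵥ y) := by
    simp only [excess, nominal]
    rw [← hX, ← hy, sub_neg_eq_add, mulVec_add (D.Rr Pn), hr]
    simp only [dotProduct_add, add_dotProduct]
    have : X *ᵥ y ⬝ᵥ D.Rr Pn *ᵥ u = u ⬝ᵥ y := by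
      rw [dotProduct_comm, mulVec_dotProduct, hrT, hr]
    rw [this, dotProduct_comm (X *ᵥ y) y]
    ring
  -- The three terms, of degree two, one and zero in `x`, are the corrections in the recursions for
  -- `P`, `η` and `γ`.
  have e2 : y ⬝ᵥ X *ᵥ y = (D.S Pn *ᵥ x) ⬝ᵥ X *ᵥ (D.S Pn *ᵥ x) +
      2 * ((D.S Pn *ᵥ x) ⬝ᵥ X *ᵥ D.g Pn ηn) + D.g Pn ηn ⬝ᵥ X *ᵥ D.g Pn ηn := by
    have : D.g Pn ηn ⬝ᵥ X *ᵥ (D.S Pn *ᵥ x) = (D.S Pn *ᵥ x) ⬝ᵥ X *ᵥ D.g Pn ηn := by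
      rw [dotProduct_comm, mulVec_dotProduct, hXT]
    simp only [hy, mulVec_add, dotProduct_add, add_dotProduct, this]
    ring
  rw [e1, e2, ricP_succ, ricη_succ, ricγ, ← hPn, ← hηn, ← hX]
  simp only [quad, sub_mulVec, dotProduct_sub, sub_dotProduct, ← mulVec_mulVec]
  rw [dotProduct_comm ((D.S Pn)ᵀ *ᵥ X *ᵥ D.g Pn ηn) x, ← mulVec_dotProduct, ← mulVec_dotProduct]
  ring

theorem excess_nonneg {D : LQData n m} {Pn : Matrix (Fin n) (Fin n) ℝ} {ηn : Fin n → ℝ}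
    (h : D.StepCondition Pn ηn) (x : Fin n → ℝ) (u : Fin m → ℝ) : 0 ≤ D.excess Pn ηn x u := by
  have := h.1.dotProduct_mulVec_nonneg (u - D.nominal Pn ηn x)
  simp only [star_trivial] at this
  unfold excess
  linarith

theorem excess_eq_zero_iff {D : LQData n m} {Pn : Matrix (Fin n) (Fin n) ℝ} {ηn : Fin n → ℝ}
    (h : D.StepCondition Pn ηn) (x : Fin n → ℝ) (u : Fin m → ℝ) :
    D.excess Pn ηn x u = 0 ↔ D.Rr Pn *ᵥ (u - D.nominal Pn ηn x) = 0 := by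
  have := h.1.dotProduct_mulVec_zero_iff (u - D.nominal Pn ηn x)
  simp only [star_trivial] at this
  rw [← this, excess]
  constructor <;> intro h <;> linarith

theorem excess_nominal_add {D : LQData n m} {Pn : Matrix (Fin n) (Fin n) ℝ} {ηn : Fin n → ℝ}
    (h : D.StepCondition Pn ηn) (x : Fin n → ℝ) (l : Fin m → ℝ) :
    D.excess Pn ηn x (D.nominal Pn ηn x + (1 - pinv (D.Rr Pn) * D.Rr Pn) *ᵥ l) = 0 := by
  rw [excess_eq_zero_iff h, add_sub_cancel_left, mulVec_mulVec, Matrix.mul_sub, ← Matrix.mul_assoc,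
    (isPseudoInverse_pinv _).mul_mul_self, Matrix.mul_one, sub_self, zero_mulVec]

/-- For `z ∈ ker 𝐑`, boundedness gives `(S x + g) ⬝ᵥ z = 0` on `G`, and this closed condition passes
to `closure G`. The direction `χ = 0` isolates `g`; a positive multiple of each `χ` then gives `S`.
The bound may depend on `x`, and `G` may omit a null set of initial states. -/
theorem stepCondition_of_bounded (Pn : Matrix (Fin n) (Fin n) ℝ) (hP : Pnᵀ = Pn) (ηn : Fin n → ℝ)
    (G : Set (Fin n → ℝ)) (hG : ∀ χ, ∃ ρ : ℝ, 0 < ρ ∧ ρ • χ ∈ closure G)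
    (hb : ∀ x ∈ G, ∃ b : ℝ, ∀ u : Fin m → ℝ,
      b ≤ 1 / 2 * (u ⬝ᵥ D.Rr Pn *ᵥ u) + u ⬝ᵥ (D.S Pn *ᵥ x + D.g Pn ηn)) :
    D.StepCondition Pn ηn := by
  have hx : ∀ x ∈ G, (D.Rr Pn).PosSemidef ∧
      ∀ z, D.Rr Pn *ᵥ z = 0 → (D.S Pn *ᵥ x + D.g Pn ηn) ⬝ᵥ z = 0 := fun x hx => by
    obtain ⟨b, hb⟩ := hb x hx
    exact bounded_quadratic _ (D.Rr_transpose _ hP) _ b hb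
  have hne : G.Nonempty := by
    obtain ⟨ρ, -, h⟩ := hG 0
    exact closure_nonempty_iff.mp ⟨_, h⟩
  refine ⟨(hx _ hne.some_mem).1, fun z hz => ?_⟩
  have hcl : IsClosed {x : Fin n → ℝ | (D.S Pn *ᵥ x + D.g Pn ηn) ⬝ᵥ z = 0} :=
    isClosed_eq (by fun_prop) continuous_const
  have hsub := closure_minimal (fun x hxG => (hx x hxG).2 z hz) hcl
  have hg : D.g Pn ηn ⬝ᵥ z = 0 := by
    obtain ⟨ρ, -, h⟩ := hG 0
    have : (D.S Pn *ᵥ (ρ • 0) + D.g Pn ηn) ⬝ᵥ z = 0 := hsub h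
    simpa using this
  refine ⟨?_, hg⟩
  have hS : ∀ χ : Fin n → ℝ, χ ⬝ᵥ (D.S Pn)ᵀ *ᵥ z = 0 := by
    intro χ
    obtain ⟨ρ, hρ, h⟩ := hG χ
    have : (D.S Pn *ᵥ (ρ • χ) + D.g Pn ηn) ⬝ᵥ z = 0 := hsub h
    simp only [add_dotProduct, hg, add_zero, mulVec_smul, smul_dotProduct,
      smul_eq_mul, mul_eq_zero, hρ.ne', false_or] at this
    rwa [← mulVec_dotProduct]
  exact dotProduct_self_eq_zero.mp (hS _)

/-! ### The linear matrix inequality -/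

theorem H_eq (P Pn : Matrix (Fin n) (Fin n) ℝ) (η ηn : Fin n → ℝ) (ξ : ℝ) :
    D.H P Pn η ηn ξ = fromBlocks (D.Rr Pn) (fromCols (D.S Pn) (replicateCol Unit (D.g Pn ηn)))
      (fromCols (D.S Pn) (replicateCol Unit (D.g Pn ηn)))ᵀ
      (fromBlocks (D.Aᵀ * Pn * D.A + D.Q - P)
        (replicateCol Unit (D.q + (D.Aᵀ * Pn) *ᵥ D.d + D.Aᵀ *ᵥ ηn - η))
        (replicateRow Unit (D.q + (D.Aᵀ * Pn) *ᵥ D.d + D.Aᵀ *ᵥ ηn - η))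
        (Matrix.of fun _ _ => ξ)) := by
  rw [transpose_fromCols, transpose_replicateCol]
  rfl

theorem schur_eq (Pn : Matrix (Fin n) (Fin n) ℝ) (ηn : Fin n → ℝ) (hP : Pnᵀ = Pn) :
    (fromCols (D.S Pn) (replicateCol Unit (D.g Pn ηn)))ᵀ * pinv (D.Rr Pn) *
        fromCols (D.S Pn) (replicateCol Unit (D.g Pn ηn)) =
      fromBlocks ((D.S Pn)ᵀ * pinv (D.Rr Pn) * D.S Pn)
        (replicateCol Unit ((D.S Pn)ᵀ *ᵥ pinv (D.Rr Pn) *ᵥ D.g Pn ηn))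
        (replicateRow Unit ((D.S Pn)ᵀ *ᵥ pinv (D.Rr Pn) *ᵥ D.g Pn ηn))
        (Matrix.of fun _ _ => D.g Pn ηn ⬝ᵥ pinv (D.Rr Pn) *ᵥ D.g Pn ηn) := by
  have hXT := pinv_transpose _ (D.Rr_transpose _ hP)
  rw [transpose_fromCols, fromRows_mul, fromRows_mul_fromCols, transpose_replicateCol]
  congr 1
  · ext i j
    simp [mulVec_mulVec, Matrix.mul_apply, mulVec, dotProduct]
  · rw [← transpose_replicateCol, ← transpose_replicateCol, replicateCol_mulVec,
      replicateCol_mulVec]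
    simp only [transpose_mul, transpose_transpose, hXT, Matrix.mul_assoc]
  · ext i j
    rw [dotProduct_mulVec]
    simp [Matrix.mul_apply, vecMul, dotProduct]

/-- With `X = [S g]`, the Schur equation for the lower right block of `H_t` reads blockwise as the
recursion for `P_t`, the recursion for `η_t`, and `ξ_t = gᵀ 𝐑† g`. -/
theorem riccatiCondition_iff_lmiCondition (ν : ℕ) : D.RiccatiCondition ν ↔ D.LMICondition ν := by
  have step : ∀ t ∈ Set.Icc 1 (ν - 1), D.P ν t = D.ricP (ν - (t + 1) + 1) ∧
      D.η ν t = D.ricη (ν - (t + 1) + 1) := fun t ht => by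
    have : ν - (t + 1) + 1 = ν - t := by have := ht.1; have := ht.2; omega
    rw [this]; exact ⟨rfl, rfl⟩
  constructor
  · intro h
    refine ⟨D.P ν, D.η ν, fun t => D.g (D.P ν (t + 1)) (D.η ν (t + 1)) ⬝ᵥ
      pinv (D.Rr (D.P ν (t + 1))) *ᵥ D.g (D.P ν (t + 1)) (D.η ν (t + 1)),
      fun t _ => D.P_transpose ν t, by simp [P, ricP], by simp [η, ricη], fun t ht => ?_⟩
    obtain ⟨e1, e2⟩ := step t ht
    have hP := D.P_transpose ν (t + 1)
    obtain ⟨h1, h2⟩ := h t ht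
    have key := fromBlocks_posSemidef_rank _ h1
      (fromCols (D.S (D.P ν (t + 1))) (replicateCol Unit (D.g (D.P ν (t + 1)) (D.η ν (t + 1)))))
      fun z hz => by
        obtain ⟨h3, h4⟩ := h2 z hz
        rw [transpose_fromCols, fromRows_mulVec, h3]
        ext (i | i)
        · rfl
        · simpa [mulVec, dotProduct] using h4
    rw [schur_eq _ _ _ hP] at key
    have f1 : D.Aᵀ * D.P ν (t + 1) * D.A + D.Q - D.P ν t =
        (D.S (D.P ν (t + 1)))ᵀ * pinv (D.Rr (D.P ν (t + 1))) * D.S (D.P ν (t + 1)) := by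
      rw [e1, ricP_succ]
      exact sub_sub_cancel _ _
    have f2 : D.q + (D.Aᵀ * D.P ν (t + 1)) *ᵥ D.d + D.Aᵀ *ᵥ D.η ν (t + 1) - D.η ν t =
        (D.S (D.P ν (t + 1)))ᵀ *ᵥ pinv (D.Rr (D.P ν (t + 1))) *ᵥ
          D.g (D.P ν (t + 1)) (D.η ν (t + 1)) := by
      rw [e2, ricη_succ, mulVec_add, mulVec_mulVec]
      simp only [P, η]
      abel
    rw [H_eq, f1, f2]
    exact key
  · rintro ⟨P, η, ξ, hsymm, hPν, hην, h⟩
    -- The rank equality alone forces any solution to follow the recursions, by induction on the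
    -- number `s` of steps to go.
    have ind : ∀ s < ν, P (ν - s) = D.ricP s ∧ η (ν - s) = D.ricη s := by
      intro s
      induction s with
      | zero => exact fun _ => ⟨hPν, hην⟩
      | succ s ih =>
        intro hs
        obtain ⟨ih1, ih2⟩ := ih (by omega)
        have h1 := (h (ν - (s + 1)) ⟨by omega, by omega⟩).2
        rw [show ν - (s + 1) + 1 = ν - s by omega, ih1, ih2, H_eq] at h1
        have hP := D.ricP_transpose s
        have h2 := (schur_eq_of_rank_fromBlocks _ (D.Rr_transpose _ hP) _ _ h1).1
        rw [schur_eq _ _ _ hP, fromBlocks_inj] at h2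
        obtain ⟨h3, h4, -, -⟩ := h2
        constructor
        · rw [ricP_succ, ← h3]
          abel
        · have := replicateCol_injective h4
          rw [ricη_succ, ← this, mulVec_add, ← mulVec_mulVec]
          abel
    intro t ht
    obtain ⟨h1, h2⟩ := h t ht
    have := ht.1
    have := ht.2
    obtain ⟨i1, i2⟩ := ind (ν - (t + 1)) (by omega)
    rw [show ν - (ν - (t + 1)) = t + 1 by omega] at i1 i2
    have hP := D.P_transpose ν (t + 1)
    change P (t + 1) = D.P ν (t + 1) at i1
    change η (t + 1) = D.η ν (t + 1) at i2
    rw [i1, i2, H_eq] at h1 h2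
    have h3 := (schur_eq_of_rank_fromBlocks _ (D.Rr_transpose _ hP) _ _ h2).2
    refine ⟨?_, fun z hz => ?_⟩
    · have := h1.submatrix Sum.inl
      exact this
    · have h4 := h3 z hz
      rw [transpose_fromCols, fromRows_mulVec] at h4
      constructor
      · ext i
        exact congrFun h4 (Sum.inl i)
      · simpa [mulVec, dotProduct] using congrFun h4 (Sum.inr ())

end LQData

end IndefLQ

/-! ### Square integrable random vectors and averaging over noise -/

namespace IndefLQ

variable {Ω : Type*} [MeasurableSpace Ω] {Pr : Measure Ω}

/-- A random vector with square integrable entries. -/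
def SqIntegrable {k : Type*} (X : Ω → k → ℝ) (Pr : Measure Ω) : Prop :=
  ∀ i, MemLp (fun ω => X ω i) 2 Pr

namespace SqIntegrable

variable {k l : Type*} [Fintype k] {X Y : Ω → k → ℝ}

theorem const [IsFiniteMeasure Pr] {k : Type*} (c : k → ℝ) : SqIntegrable (fun _ : Ω => c) Pr :=
  fun i => memLp_const (c i)

theorem add {k : Type*} {X Y : Ω → k → ℝ} (hX : SqIntegrable X Pr) (hY : SqIntegrable Y Pr) :
    SqIntegrable (fun ω => X ω + Y ω) Pr :=
  fun i => (hX i).add (hY i)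

theorem sub {k : Type*} {X Y : Ω → k → ℝ} (hX : SqIntegrable X Pr) (hY : SqIntegrable Y Pr) :
    SqIntegrable (fun ω => X ω - Y ω) Pr :=
  fun i => (hX i).sub (hY i)

theorem neg {k : Type*} {X : Ω → k → ℝ} (hX : SqIntegrable X Pr) :
    SqIntegrable (fun ω => -X ω) Pr :=
  fun i => (hX i).neg

theorem mulVec (hX : SqIntegrable X Pr) (M : Matrix l k ℝ) :
    SqIntegrable (fun ω => M *ᵥ X ω) Pr :=
  fun i => memLp_finsetSum _ fun j _ => (hX j).const_mul (M i j)

theorem integrable_dotProduct (hX : SqIntegrable X Pr) (hY : SqIntegrable Y Pr) :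
    Integrable (fun ω => X ω ⬝ᵥ Y ω) Pr :=
  integrable_finsetSum _ fun i _ => (hX i).integrable_mul (hY i)

theorem integral_dotProduct (hX : SqIntegrable X Pr) (hY : SqIntegrable Y Pr) :
    ∫ ω, X ω ⬝ᵥ Y ω ∂Pr = ∑ i, ∫ ω, X ω i * Y ω i ∂Pr :=
  integral_finsetSum _ fun i _ => (hX i).integrable_mul (hY i)

theorem of_integrable_dotProduct_self (hX : Measurable X)
    (h : Integrable (fun ω => X ω ⬝ᵥ X ω) Pr) : SqIntegrable X Pr := by
  intro i
  have hm : Measurable (fun ω => X ω i) := (measurable_pi_apply i).comp hX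
  rw [memLp_two_iff_integrable_sq hm.aestronglyMeasurable]
  refine h.mono' (hm.pow_const 2).aestronglyMeasurable (ae_of_all _ fun ω => ?_)
  rw [Real.norm_of_nonneg (sq_nonneg _), sq]
  exact Finset.single_le_sum (f := fun i => X ω i * X ω i) (fun j _ => mul_self_nonneg _)
    (Finset.mem_univ i)

end SqIntegrable

theorem SqIntegrable.integrable_quad [IsFiniteMeasure Pr] {n : ℕ} {Y : Ω → Fin n → ℝ}
    (hY : SqIntegrable Y Pr) (P : Matrix (Fin n) (Fin n) ℝ) (η : Fin n → ℝ) (c : ℝ) :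
    Integrable (fun ω => quad P η c (Y ω)) Pr :=
  (((hY.integrable_dotProduct (hY.mulVec P)).const_mul (1 / 2)).add
    ((SqIntegrable.const η).integrable_dotProduct hY)).add (integrable_const c)

/-- Adding independent centred noise to the argument of a quadratic polynomial. -/
theorem integral_quad_add [IsProbabilityMeasure Pr] {n : ℕ} {Y e : Ω → Fin n → ℝ}
    (hY : SqIntegrable Y Pr) (he : SqIntegrable e Pr) (hind : IndepFun Y e Pr)
    {C : Matrix (Fin n) (Fin n) ℝ} (hmean : ∀ i, ∫ ω, e ω i ∂Pr = 0)
    (hcov : ∀ i j, cov[fun ω => e ω i, fun ω => e ω j; Pr] = C i j)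
    (P : Matrix (Fin n) (Fin n) ℝ) (hP : Pᵀ = P) (η : Fin n → ℝ) (c : ℝ) :
    ∫ ω, quad P η c (Y ω + e ω) ∂Pr = ∫ ω, quad P η (c + 1 / 2 * (P * C).trace) (Y ω) ∂Pr := by
  have hZ : SqIntegrable (fun ω => P *ᵥ Y ω + η) Pr := (hY.mulVec P).add (SqIntegrable.const η)
  -- The cross term is a sum of products of independent factors, the second with mean zero.
  have h1 : ∫ ω, (P *ᵥ Y ω + η) ⬝ᵥ e ω ∂Pr = 0 := by
    rw [hZ.integral_dotProduct he]
    refine Finset.sum_eq_zero fun i _ => ?_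
    have hi : IndepFun (fun ω => (P *ᵥ Y ω + η) i) (fun ω => e ω i) Pr :=
      hind.comp (φ := fun y : Fin n → ℝ => (P *ᵥ y + η) i) (ψ := fun y : Fin n → ℝ => y i)
        (by fun_prop : Continuous fun y : Fin n → ℝ => (P *ᵥ y + η) i).measurable
        (measurable_pi_apply i)
    have := hi.integral_mul_eq_mul_integral (hZ i).aestronglyMeasurable (he i).aestronglyMeasurable
    rw [hmean i, mul_zero] at this
    exact this
  -- Since the mean is zero, second moments are covariances.
  have h2 : ∫ ω, e ω ⬝ᵥ P *ᵥ e ω ∂Pr = (P * C).trace := by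
    have hm : ∀ i j, ∫ ω, e ω i * e ω j ∂Pr = C i j := fun i j => by
      have := covariance_eq_sub (he i) (he j)
      rw [hcov, hmean, zero_mul, sub_zero] at this
      exact this.symm
    rw [he.integral_dotProduct (he.mulVec P)]
    simp only [Matrix.trace, Matrix.diag_apply, Matrix.mul_apply]
    refine Finset.sum_congr rfl fun i _ => ?_
    simp only [Matrix.mulVec, dotProduct, Finset.mul_sum]
    have hint : ∀ j ∈ Finset.univ, Integrable (fun ω => e ω i * (P i j * e ω j)) Pr :=
      fun j _ => (he i).integrable_mul ((he j).const_mul (P i j))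
    rw [integral_finsetSum _ hint]
    refine Finset.sum_congr rfl fun j _ => ?_
    rw [← hm j i, ← integral_const_mul]
    congr 1
    funext ω
    ring
  have h3 : ∀ ω, quad P η c (Y ω + e ω) =
      quad P η c (Y ω) + (P *ᵥ Y ω + η) ⬝ᵥ e ω + 1 / 2 * (e ω ⬝ᵥ P *ᵥ e ω) :=
    fun ω => quad_add P hP η c _ _
  have i1 := hY.integrable_quad P η c
  have i2 := hZ.integrable_dotProduct he
  have i3 := (he.integrable_dotProduct (he.mulVec P)).const_mul (1 / 2)
  simp only [h3]
  have i12 : Integrable (fun ω => quad P η c (Y ω) + (P *ᵥ Y ω + η) ⬝ᵥ e ω) Pr := i1.add i2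
  rw [integral_add i12 i3, integral_add i1 i2, integral_const_mul, h1, h2, add_zero]
  have h4 : ∀ ω, quad P η (c + 1 / 2 * (P * C).trace) (Y ω) =
      quad P η c (Y ω) + 1 / 2 * (P * C).trace := fun ω => by simp only [quad]; ring
  simp only [h4]
  rw [integral_add i1 (integrable_const _), integral_const]
  simp

/-! ### The state process and the cost of admissible strategies -/

namespace LQData

variable {n m : ℕ} {D : LQData n m} {w : ℕ → Ω → Fin n → ℝ} {ν N : ℕ} {x : Fin n → ℝ}
  {μ : ℕ → (Fin n → ℝ) → (Fin m → ℝ)}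

theorem state_eq_init {Ω : Type*} (D : LQData n m) (w : ℕ → Ω → Fin n → ℝ) (x : Fin n → ℝ)
    (μ : ℕ → (Fin n → ℝ) → (Fin m → ℝ)) {t : ℕ} (ht : t ≤ ν - N + 1) (ω : Ω) :
    D.state w ν N x μ t ω = x := by
  induction t with
  | zero => rfl
  | succ t ih => rw [state, if_pos (by omega), ih (by omega)]

theorem state_succ {Ω : Type*} (D : LQData n m) (w : ℕ → Ω → Fin n → ℝ) (x : Fin n → ℝ)
    (μ : ℕ → (Fin n → ℝ) → (Fin m → ℝ)) {t : ℕ} (ht : ν - N < t) (ω : Ω) :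
    D.state w ν N x μ (t + 1) ω = D.A *ᵥ D.state w ν N x μ t ω +
      D.B *ᵥ μ t (D.state w ν N x μ t ω) + D.d + w t ω := by
  rw [state, if_neg (by omega)]

/-- The σ-algebra is left free, so that it can also be the one generated by the noise before time
`t`; this is what independence of `x_t` and `w_t` rests on. -/
theorem measurable_state' {Ω : Type*} (mΩ : MeasurableSpace Ω) (D : LQData n m)
    (w : ℕ → Ω → Fin n → ℝ) (x : Fin n → ℝ) (μ : ℕ → (Fin n → ℝ) → (Fin m → ℝ))
    (hμ : ∀ t ∈ Set.Icc 1 (ν - 1), Measurable (μ t)) (t : ℕ) (ht : t ≤ ν)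
    (hw : ∀ s, 1 ≤ s → s < t → Measurable (w s)) : Measurable (D.state w ν N x μ t) := by
  induction t with
  | zero => exact measurable_const
  | succ t ih =>
    have ih := ih (by omega) fun s h1 h2 => hw s h1 (by omega)
    by_cases h : t ≤ ν - N
    · have : D.state w ν N x μ (t + 1) = D.state w ν N x μ t := by
        funext ω
        rw [state, if_pos h]
      rwa [this]
    · have : D.state w ν N x μ (t + 1) = fun ω => D.A *ᵥ D.state w ν N x μ t ω +
          D.B *ᵥ μ t (D.state w ν N x μ t ω) + D.d + w t ω := by
        funext ω
        exact state_succ D w x μ (by omega) ω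
      rw [this]
      have hA : Measurable fun y : Fin n → ℝ => D.A *ᵥ y :=
        (by fun_prop : Continuous fun y : Fin n → ℝ => D.A *ᵥ y).measurable
      have hB : Measurable fun y : Fin m → ℝ => D.B *ᵥ y :=
        (by fun_prop : Continuous fun y : Fin m → ℝ => D.B *ᵥ y).measurable
      have hm := hμ t ⟨by omega, by omega⟩
      exact (((hA.comp ih).add (hB.comp (hm.comp ih))).add_const _).add (hw t (by omega) (by omega))

theorem measurable_state {C : Matrix (Fin n) (Fin n) ℝ} (hw : IsNoise Pr w C)
    (hμ : ∀ t ∈ Set.Icc 1 (ν - 1), Measurable (μ t)) {t : ℕ} (ht : t ≤ ν) :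
    Measurable (D.state w ν N x μ t) :=
  measurable_state' _ D w x μ hμ t ht fun s hs _ => hw.measurable s hs

theorem indepFun_state {C : Matrix (Fin n) (Fin n) ℝ} (hw : IsNoise Pr w C)
    (hμ : ∀ t ∈ Set.Icc 1 (ν - 1), Measurable (μ t)) {t : ℕ} (h1 : 1 ≤ t) (ht : t ≤ ν) :
    IndepFun (D.state w ν N x μ t) (w t) Pr := by
  -- The independent family is shifted by one: `w t` has index `t - 1`, and the past noise has the
  -- indices below it.
  have h := hw.indep.indepFun_finset (Finset.range (t - 1)) {t - 1} (by simp)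
    fun i => hw.measurable (i + 1) (by omega)
  have hl : MeasurableSpace.comap (D.state w ν N x μ t) inferInstance ≤ MeasurableSpace.comap
      (fun ω (i : Finset.range (t - 1)) => w (i + 1) ω) inferInstance := by
    refine Measurable.comap_le (measurable_state' _ D w x μ hμ t ht fun s hs1 hs2 => ?_)
    have : w s = (fun z : Finset.range (t - 1) → Fin n → ℝ =>
        z ⟨s - 1, Finset.mem_range.mpr (by omega)⟩) ∘
        fun ω (i : Finset.range (t - 1)) => w (i + 1) ω := by
      funext ω
      simp only [Function.comp]
      rw [Nat.sub_add_cancel hs1]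
    rw [this]
    exact (measurable_pi_apply _).comp (comap_measurable _)
  have hr : MeasurableSpace.comap (w t) inferInstance ≤ MeasurableSpace.comap
      (fun ω (i : ({t - 1} : Finset ℕ)) => w (i + 1) ω) inferInstance := by
    refine Measurable.comap_le ?_
    have : w t = (fun z : ({t - 1} : Finset ℕ) → Fin n → ℝ =>
        z ⟨t - 1, Finset.mem_singleton_self _⟩) ∘
        fun ω (i : ({t - 1} : Finset ℕ)) => w (i + 1) ω := by
      funext ω
      simp only [Function.comp]
      rw [Nat.sub_add_cancel h1]
    rw [this]
    exact (measurable_pi_apply _).comp (comap_measurable _)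
  rw [IndepFun_iff_Indep] at h ⊢
  exact indep_of_indep_of_le_left (indep_of_indep_of_le_right h hr) hl

/-- Only controls before time `t` enter, so under state feedback integrability of states and
controls can be obtained alternately by induction. -/
theorem sqIntegrable_state [IsProbabilityMeasure Pr] {C : Matrix (Fin n) (Fin n) ℝ}
    (hw : IsNoise Pr w C) {t : ℕ}
    (hu : ∀ s, ν - N < s → s < t → SqIntegrable (fun ω => μ s (D.state w ν N x μ s ω)) Pr) :
    SqIntegrable (D.state w ν N x μ t) Pr := by
  induction t with
  | zero => exact SqIntegrable.const x
  | succ t ih =>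
    have ih := ih fun s h1 h2 => hu s h1 (by omega)
    by_cases h : t ≤ ν - N
    · have : D.state w ν N x μ (t + 1) = fun _ => x := by
        funext ω
        exact state_eq_init D w x μ (by omega) ω
      rw [this]
      exact SqIntegrable.const x
    · have : D.state w ν N x μ (t + 1) = fun ω => D.A *ᵥ D.state w ν N x μ t ω +
          D.B *ᵥ μ t (D.state w ν N x μ t ω) + D.d + w t ω := by
        funext ω
        exact state_succ D w x μ (by omega) ω
      rw [this]
      exact (((ih.mulVec D.A).add ((hu t (by omega) (by omega)).mulVec D.B)).add
        (SqIntegrable.const D.d)).add (hw.memLp t (by omega))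

theorem Admissible.sqIntegrable_control {C : Matrix (Fin n) (Fin n) ℝ} (hw : IsNoise Pr w C)
    (h : D.Admissible Pr w ν N x μ) {t : ℕ} (h1 : ν - N < t) (h2 : t < ν) :
    SqIntegrable (fun ω => μ t (D.state w ν N x μ t ω)) Pr :=
  .of_integrable_dotProduct_self
    ((h.measurable t ⟨by omega, by omega⟩).comp (measurable_state hw h.measurable h2.le))
    (h.sq_integrable t ⟨by omega, by omega⟩)

theorem Admissible.sqIntegrable_state [IsProbabilityMeasure Pr] {C : Matrix (Fin n) (Fin n) ℝ}
    (hw : IsNoise Pr w C) (h : D.Admissible Pr w ν N x μ) {t : ℕ} (ht : t ≤ ν) :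
    SqIntegrable (D.state w ν N x μ t) Pr :=
  LQData.sqIntegrable_state hw fun _ h1 h2 => h.sqIntegrable_control hw h1 (by omega)

/-- Affine feedback is admissible. -/
theorem admissible_of_affine [IsProbabilityMeasure Pr] {C : Matrix (Fin n) (Fin n) ℝ}
    (hw : IsNoise Pr w C) (h0 : ∀ t ≤ ν - N, ∀ χ, μ t χ = 0)
    (haff : ∀ t, ν - N < t → ∃ (K : Matrix (Fin m) (Fin n) ℝ) (k : Fin m → ℝ),
      ∀ χ, μ t χ = K *ᵥ χ + k) : D.Admissible Pr w ν N x μ := by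
  have hu : ∀ t, ν - N < t → SqIntegrable (fun ω => μ t (D.state w ν N x μ t ω)) Pr := by
    intro t
    induction t using Nat.strong_induction_on with
    | _ t ih =>
      intro ht
      obtain ⟨K, k, hK⟩ := haff t ht
      simp only [hK]
      exact ((sqIntegrable_state hw fun s h1 h2 => ih s h2 h1).mulVec K).add (.const k)
  refine ⟨fun t _ => ?_, fun t ht => h0 t ht.2, fun t ht => ?_⟩
  · by_cases h : t ≤ ν - N
    · have : μ t = fun _ => 0 := funext (h0 t h)
      rw [this]
      exact measurable_const
    · obtain ⟨K, k, hK⟩ := haff t (by omega)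
      have : μ t = fun χ => K *ᵥ χ + k := funext hK
      rw [this]
      exact (by fun_prop : Continuous fun χ : Fin n → ℝ => K *ᵥ χ + k).measurable
  · have := hu t ht.1
    exact this.integrable_dotProduct this

theorem integrable_stageCost [IsProbabilityMeasure Pr] {X : Ω → Fin n → ℝ} {U : Ω → Fin m → ℝ}
    (hX : SqIntegrable X Pr) (hU : SqIntegrable U Pr) :
    Integrable (fun ω => D.stageCost (X ω) (U ω)) Pr := by
  have h1 := hX.integrable_quad D.Q D.q 0
  have h2 := (hU.integrable_dotProduct (hU.mulVec D.R)).const_mul (1 / 2)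
  refine (h1.add h2).congr (ae_of_all _ fun ω => ?_)
  simp [quad, stageCost, stateCost]

/-- The Riccati condition at time `t`. -/
def ConditionAt (D : LQData n m) (ν t : ℕ) : Prop :=
  D.StepCondition (D.P ν (t + 1)) (D.η ν (t + 1))

/-- The quadratic value function `½ χᵀ P_t χ + η_tᵀ χ + γ_t`. -/
noncomputable def value (D : LQData n m) (C : Matrix (Fin n) (Fin n) ℝ) (ν t : ℕ)
    (χ : Fin n → ℝ) : ℝ :=
  quad (D.P ν t) (D.η ν t) (D.γ C ν t) χ

theorem value_terminal (D : LQData n m) (C : Matrix (Fin n) (Fin n) ℝ) (ν : ℕ) (χ : Fin n → ℝ) :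
    D.value C ν ν χ = D.stateCost χ := by
  simp [value, quad, P, η, γ, ricP, ricη, ricγ, stateCost]

theorem stageCost_add_value (D : LQData n m) (C : Matrix (Fin n) (Fin n) ℝ) {ν t : ℕ} (ht : t < ν)
    (h : D.ConditionAt ν t) (x : Fin n → ℝ) (u : Fin m → ℝ) :
    D.stageCost x u + quad (D.P ν (t + 1)) (D.η ν (t + 1))
        (D.γ C ν (t + 1) + 1 / 2 * (D.P ν (t + 1) * C).trace) (D.A *ᵥ x + D.B *ᵥ u + D.d) =
      D.value C ν t x + D.excess (D.P ν (t + 1)) (D.η ν (t + 1)) x u := by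
  have := D.stageCost_add_quad_eq C (ν - (t + 1)) h x u
  rw [show ν - (t + 1) + 1 = ν - t by omega] at this
  exact this

theorem integral_value_add_noise [IsProbabilityMeasure Pr] (D : LQData n m)
    {C : Matrix (Fin n) (Fin n) ℝ} (hw : IsNoise Pr w C) {t : ℕ} (h1 : 1 ≤ t)
    {Y : Ω → Fin n → ℝ} (hY : SqIntegrable Y Pr) (hind : IndepFun Y (w t) Pr) (s : ℕ) :
    Integrable (fun ω => D.value C ν s (Y ω + w t ω)) Pr ∧
    ∫ ω, D.value C ν s (Y ω + w t ω) ∂Pr = ∫ ω, quad (D.P ν s) (D.η ν s)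
      (D.γ C ν s + 1 / 2 * (D.P ν s * C).trace) (Y ω) ∂Pr :=
  ⟨(hY.add (hw.memLp t h1)).integrable_quad _ _ _,
    integral_quad_add hY (hw.memLp t h1) hind (hw.mean t h1) (hw.cov t h1) _
      (D.P_transpose ν s) _ _⟩

theorem sqIntegrable_nominal [IsProbabilityMeasure Pr] {X : Ω → Fin n → ℝ}
    (hX : SqIntegrable X Pr) (Pn : Matrix (Fin n) (Fin n) ℝ) (ηn : Fin n → ℝ) :
    SqIntegrable (fun ω => D.nominal Pn ηn (X ω)) Pr :=
  (((hX.mulVec (D.S Pn)).add (.const (D.g Pn ηn))).mulVec (pinv (D.Rr Pn))).neg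

theorem integrable_excess [IsProbabilityMeasure Pr] {X : Ω → Fin n → ℝ} {U : Ω → Fin m → ℝ}
    (hX : SqIntegrable X Pr) (hU : SqIntegrable U Pr) (Pn : Matrix (Fin n) (Fin n) ℝ)
    (ηn : Fin n → ℝ) : Integrable (fun ω => D.excess Pn ηn (X ω) (U ω)) Pr := by
  have := hU.sub (sqIntegrable_nominal (D := D) hX Pn ηn)
  exact (this.integrable_dotProduct (this.mulVec _)).const_mul _

/-- The cost of one stage plus the expected value function at the next time. -/
theorem Admissible.integral_stage_add_value [IsProbabilityMeasure Pr] {C : Matrix (Fin n) (Fin n) ℝ}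
    (hw : IsNoise Pr w C) (h : D.Admissible Pr w ν N x μ) {t : ℕ} (h1 : ν - N < t) (h2 : t < ν) :
    (∫ ω, D.stageCost (D.state w ν N x μ t ω) (μ t (D.state w ν N x μ t ω)) ∂Pr) +
      ∫ ω, D.value C ν (t + 1) (D.state w ν N x μ (t + 1) ω) ∂Pr =
    ∫ ω, (D.stageCost (D.state w ν N x μ t ω) (μ t (D.state w ν N x μ t ω)) +
      quad (D.P ν (t + 1)) (D.η ν (t + 1)) (D.γ C ν (t + 1) + 1 / 2 * (D.P ν (t + 1) * C).trace)
        (D.A *ᵥ D.state w ν N x μ t ω + D.B *ᵥ μ t (D.state w ν N x μ t ω) + D.d)) ∂Pr := by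
  have hX := h.sqIntegrable_state hw h2.le
  have hU := h.sqIntegrable_control hw h1 h2
  have hY := ((hX.mulVec D.A).add (hU.mulVec D.B)).add (.const D.d)
  have hind : IndepFun (fun ω => D.A *ᵥ D.state w ν N x μ t ω +
      D.B *ᵥ μ t (D.state w ν N x μ t ω) + D.d) (w t) Pr := by
    refine (indepFun_state (D := D) (N := N) (x := x) hw h.measurable (t := t) (by omega) h2.le).comp
      (φ := fun y => D.A *ᵥ y + D.B *ᵥ μ t y + D.d) (ψ := id) ?_ measurable_id
    have hA : Measurable fun y : Fin n → ℝ => D.A *ᵥ y :=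
      (by fun_prop : Continuous fun y : Fin n → ℝ => D.A *ᵥ y).measurable
    have hB : Measurable fun y : Fin m → ℝ => D.B *ᵥ y :=
      (by fun_prop : Continuous fun y : Fin m → ℝ => D.B *ᵥ y).measurable
    exact (hA.add (hB.comp (h.measurable t ⟨by omega, by omega⟩))).add_const _
  simp only [state_succ D w x μ h1]
  rw [(D.integral_value_add_noise hw (by omega) hY hind (t + 1)).2,
    integral_add (integrable_stageCost hX hU) (hY.integrable_quad _ _ _)]

/-- The telescoping step: the expected value function moves from `t + 1` to `t`, leaving the
expected excess. -/
theorem Admissible.integral_stage_eq [IsProbabilityMeasure Pr] {C : Matrix (Fin n) (Fin n) ℝ}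
    (hw : IsNoise Pr w C) (h : D.Admissible Pr w ν N x μ) {t : ℕ} (h1 : ν - N < t) (h2 : t < ν)
    (hc : D.ConditionAt ν t) :
    (∫ ω, D.stageCost (D.state w ν N x μ t ω) (μ t (D.state w ν N x μ t ω)) ∂Pr) +
      ∫ ω, D.value C ν (t + 1) (D.state w ν N x μ (t + 1) ω) ∂Pr =
    (∫ ω, D.value C ν t (D.state w ν N x μ t ω) ∂Pr) +
      ∫ ω, D.excess (D.P ν (t + 1)) (D.η ν (t + 1)) (D.state w ν N x μ t ω)
        (μ t (D.state w ν N x μ t ω)) ∂Pr := by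
  have hX := h.sqIntegrable_state hw h2.le
  have hU := h.sqIntegrable_control hw h1 h2
  rw [h.integral_stage_add_value hw h1 h2]
  simp only [D.stageCost_add_value C h2 hc]
  exact integral_add (hX.integrable_quad _ _ _) (integrable_excess hX hU _ _)

/-- The cost-to-go from time `T` in terms of the value function and the excess costs. -/
theorem Admissible.integral_tail [IsProbabilityMeasure Pr] {C : Matrix (Fin n) (Fin n) ℝ}
    (hw : IsNoise Pr w C) (h : D.Admissible Pr w ν N x μ) {T : ℕ} (h1 : ν - N < T) (h2 : T ≤ ν)
    (hc : ∀ t ∈ Set.Ico T ν, D.ConditionAt ν t) :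
    (∫ ω, D.stateCost (D.state w ν N x μ ν ω) ∂Pr) + ∑ t ∈ Finset.Ico T ν,
      ∫ ω, D.stageCost (D.state w ν N x μ t ω) (μ t (D.state w ν N x μ t ω)) ∂Pr =
    (∫ ω, D.value C ν T (D.state w ν N x μ T ω) ∂Pr) + ∑ t ∈ Finset.Ico T ν,
      ∫ ω, D.excess (D.P ν (t + 1)) (D.η ν (t + 1)) (D.state w ν N x μ t ω)
        (μ t (D.state w ν N x μ t ω)) ∂Pr := by
  induction h2 using Nat.decreasingInduction with
  | self => simp [value_terminal]
  | of_succ T hT ih =>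
    have ih := ih (by omega) fun t ht => hc t ⟨by have := ht.1; omega, ht.2⟩
    have := h.integral_stage_eq hw h1 hT (hc T ⟨le_rfl, hT⟩)
    rw [Finset.sum_eq_sum_Ico_succ_bot hT, Finset.sum_eq_sum_Ico_succ_bot hT]
    linarith

theorem Admissible.cost_eq [IsProbabilityMeasure Pr] {C : Matrix (Fin n) (Fin n) ℝ}
    (hw : IsNoise Pr w C) (h : D.Admissible Pr w ν N x μ) (hN : N ∈ Set.Icc 2 ν) :
    D.cost Pr w ν N x μ = (∫ ω, D.stateCost (D.state w ν N x μ ν ω) ∂Pr) +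
      ∑ t ∈ Finset.Ico (ν - N + 1) ν,
        ∫ ω, D.stageCost (D.state w ν N x μ t ω) (μ t (D.state w ν N x μ t ω)) ∂Pr := by
  obtain ⟨hN1, hN2⟩ := hN
  have hI : Finset.Icc (ν - N + 1) (ν - 1) = Finset.Ico (ν - N + 1) ν := by
    ext t
    simp only [Finset.mem_Icc, Finset.mem_Ico]
    omega
  have hi : ∀ t ∈ Finset.Ico (ν - N + 1) ν, Integrable (fun ω =>
      D.stageCost (D.state w ν N x μ t ω) (μ t (D.state w ν N x μ t ω))) Pr := fun t ht => by
    rw [Finset.mem_Ico] at ht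
    exact integrable_stageCost (h.sqIntegrable_state hw ht.2.le)
      (h.sqIntegrable_control hw ht.1 ht.2)
  have h0 : Integrable (fun ω => D.stateCost (D.state w ν N x μ ν ω)) Pr := by
    simp only [← D.value_terminal C ν]
    exact (h.sqIntegrable_state hw le_rfl).integrable_quad _ _ _
  rw [cost, hI, integral_add h0 (integrable_finsetSum _ hi), integral_finsetSum _ hi]

variable {Ω : Type*} [MeasurableSpace Ω] {Pr : Measure Ω} [IsProbabilityMeasure Pr]
  {n m : ℕ} {D : LQData n m} {w : ℕ → Ω → Fin n → ℝ} {ν N : ℕ} {C : Matrix (Fin n) (Fin n) ℝ}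

/-! ### Solutions of the Hamilton-Jacobi-Bellman equation -/

theorem bellman_of_value (hw : IsNoise Pr w C) {V : ℕ → (Fin n → ℝ) → ℝ} {t : ℕ} (h1 : 1 ≤ t)
    (hV : ∀ χ, V (t + 1) χ = D.value C ν (t + 1) χ) (χ : Fin n → ℝ) (u : Fin m → ℝ) :
    D.bellman Pr w V t χ u = D.stageCost χ u + quad (D.P ν (t + 1)) (D.η ν (t + 1))
      (D.γ C ν (t + 1) + 1 / 2 * (D.P ν (t + 1) * C).trace) (D.A *ᵥ χ + D.B *ᵥ u + D.d) := by
  have := (D.integral_value_add_noise (ν := ν) hw h1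
    (SqIntegrable.const (D.A *ᵥ χ + D.B *ᵥ u + D.d)) (indepFun_const_left _ _) (t + 1)).2
  simp only [bellman, hV, this, integral_const]
  simp

theorem isLeast_value (hw : IsNoise Pr w C) {V : ℕ → (Fin n → ℝ) → ℝ} {t : ℕ}
    (ht : t ∈ Set.Icc 1 (ν - 1)) (hV : ∀ χ, V (t + 1) χ = D.value C ν (t + 1) χ)
    (hc : D.ConditionAt ν t) (χ : Fin n → ℝ) :
    IsLeast (Set.range (D.bellman Pr w V t χ)) (D.value C ν t χ) := by
  obtain ⟨h1, h2⟩ := ht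
  have hb : ∀ u, D.bellman Pr w V t χ u =
      D.value C ν t χ + D.excess (D.P ν (t + 1)) (D.η ν (t + 1)) χ u := fun u => by
    rw [bellman_of_value hw h1 hV, D.stageCost_add_value C (by omega) hc]
  constructor
  · refine ⟨D.nominal (D.P ν (t + 1)) (D.η ν (t + 1)) χ, ?_⟩
    have := excess_nominal_add hc χ 0
    rw [mulVec_zero, add_zero] at this
    rw [hb, this, add_zero]
  · rintro _ ⟨u, rfl⟩
    rw [hb]
    have := excess_nonneg hc χ u
    linarith

theorem conditionAt_of_isGLB (hw : IsNoise Pr w C) {V : ℕ → (Fin n → ℝ) → ℝ} {t : ℕ}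
    (h1 : 1 ≤ t) (hV : ∀ χ, V (t + 1) χ = D.value C ν (t + 1) χ)
    (hglb : ∀ χ, IsGLB (Set.range (D.bellman Pr w V t χ)) (V t χ)) : D.ConditionAt ν t := by
  refine D.stepCondition_of_bounded _ (D.P_transpose ν _) _ Set.univ
    (fun χ => ⟨1, one_pos, by simp⟩) fun χ _ => ?_
  -- The bound is the infimum minus the part of the minimized expression that is free of `u`.
  refine ⟨V t χ - quad (D.Aᵀ * D.P ν (t + 1) * D.A + D.Q)
    (D.Aᵀ *ᵥ (D.η ν (t + 1) + D.P ν (t + 1) *ᵥ D.d) + D.q)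
    (1 / 2 * (D.d ⬝ᵥ D.P ν (t + 1) *ᵥ D.d) + D.η ν (t + 1) ⬝ᵥ D.d +
      (D.γ C ν (t + 1) + 1 / 2 * (D.P ν (t + 1) * C).trace)) χ, fun u => ?_⟩
  have := (hglb χ).1 ⟨u, rfl⟩
  rw [bellman_of_value hw h1 hV, D.stageCost_add_quad _ (D.P_transpose ν _)] at this
  linarith

/-- Backward induction: once `V (t + 1)` is the quadratic value, a finite infimum at time `t` forces
the condition there. The minimum is then attained with quadratic value, and the infimum is unique.
-/
theorem SolvesHJBInf.spec (hw : IsNoise Pr w C) {V : ℕ → (Fin n → ℝ) → ℝ}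
    (hV : D.SolvesHJBInf Pr w ν V) :
    D.RiccatiCondition ν ∧ D.SolvesHJB Pr w ν V ∧ D.IsQuadraticValue C ν V := by
  have step : ∀ t ∈ Set.Icc 1 (ν - 1), (∀ χ, V (t + 1) χ = D.value C ν (t + 1) χ) →
      D.ConditionAt ν t ∧ (∀ χ, V t χ = D.value C ν t χ) := fun t ht h => by
    have hc := conditionAt_of_isGLB hw ht.1 h (hV.2 t ht)
    exact ⟨hc, fun χ => (hV.2 t ht χ).unique (isLeast_value hw ht h hc χ).isGLB⟩
  have ind : ∀ s < ν, ∀ χ, V (ν - s) χ = D.value C ν (ν - s) χ := by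
    intro s
    induction s with
    | zero =>
      intro _ χ
      rw [Nat.sub_zero, value_terminal, hV.1.terminal]
    | succ s ih =>
      intro hs
      refine (step (ν - (s + 1)) ⟨by omega, by omega⟩ ?_).2
      rw [show ν - (s + 1) + 1 = ν - s by omega]
      exact ih (by omega)
  have hval : ∀ t ∈ Set.Icc 1 ν, ∀ χ, V t χ = D.value C ν t χ := fun t ht => by
    have := ht.1
    have := ht.2
    have h := ind (ν - t) (by omega)
    rwa [show ν - (ν - t) = t by omega] at h
  have hval' : ∀ t ∈ Set.Icc 1 (ν - 1), ∀ χ, V (t + 1) χ = D.value C ν (t + 1) χ := fun t ht =>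
    hval (t + 1) ⟨by omega, by have := ht.1; have := ht.2; omega⟩
  have hR : ∀ t ∈ Set.Icc 1 (ν - 1), D.ConditionAt ν t := fun t ht => (step t ht (hval' t ht)).1
  refine ⟨hR, ⟨hV.1, fun t ht χ => ?_⟩, hval⟩
  rw [(step t ht (hval' t ht)).2 χ]
  exact isLeast_value hw ht (hval' t ht) (hR t ht) χ

theorem RiccatiCondition.solvesHJB (hw : IsNoise Pr w C) (h : D.RiccatiCondition ν) :
    D.SolvesHJB Pr w ν (D.value C ν) ∧ D.IsQuadraticValue C ν (D.value C ν) := by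
  refine ⟨⟨⟨D.value_terminal C ν, fun t ht χ u => ?_⟩, fun t ht χ =>
    isLeast_value hw ht (fun _ => rfl) (h t ht) χ⟩, fun t _ χ => rfl⟩
  exact (D.integral_value_add_noise hw ht.1 (SqIntegrable.const (D.A *ᵥ χ + D.B *ᵥ u + D.d))
    (indepFun_const_left _ _) (t + 1)).1

/-! ### Optimal controls -/

theorem control_eq (D : LQData n m) (ν t : ℕ) (χ : Fin n → ℝ) (l : Fin m → ℝ) :
    D.control ν t χ l = D.nominal (D.P ν (t + 1)) (D.η ν (t + 1)) χ +
      (1 - pinv (D.Rr (D.P ν (t + 1))) * D.Rr (D.P ν (t + 1))) *ᵥ l := rfl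

theorem exists_nominal_add_eq_affine (D : LQData n m) (Pn : Matrix (Fin n) (Fin n) ℝ)
    (ηn : Fin n → ℝ) (c : Fin m → ℝ) : ∃ (K : Matrix (Fin m) (Fin n) ℝ) (k : Fin m → ℝ),
      ∀ χ, D.nominal Pn ηn χ + c = K *ᵥ χ + k := by
  refine ⟨-(pinv (D.Rr Pn) * D.S Pn), -(pinv (D.Rr Pn) *ᵥ D.g Pn ηn) + c, fun χ => ?_⟩
  rw [nominal, mulVec_add, neg_mulVec, mulVec_mulVec, neg_add, add_assoc]

theorem admissible_strategy (hw : IsNoise Pr w C) (l : ℕ → Fin m → ℝ) (x : Fin n → ℝ) :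
    D.Admissible Pr w ν N x (D.strategy ν N l) := by
  refine admissible_of_affine hw (fun t ht χ => if_pos ht) fun t ht => ?_
  obtain ⟨K, k, h⟩ := D.exists_nominal_add_eq_affine (D.P ν (t + 1)) (D.η ν (t + 1))
    ((1 - pinv (D.Rr (D.P ν (t + 1))) * D.Rr (D.P ν (t + 1))) *ᵥ l t)
  refine ⟨K, k, fun χ => ?_⟩
  rw [strategy, if_neg (by omega), control_eq, h]

theorem RiccatiCondition.cost_eq (hw : IsNoise Pr w C) (h : D.RiccatiCondition ν)
    (hN : N ∈ Set.Icc 2 ν) {x : Fin n → ℝ} {μ : ℕ → (Fin n → ℝ) → (Fin m → ℝ)}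
    (hμ : D.Admissible Pr w ν N x μ) :
    D.cost Pr w ν N x μ = D.value C ν (ν - N + 1) x + ∑ t ∈ Finset.Ico (ν - N + 1) ν,
      ∫ ω, D.excess (D.P ν (t + 1)) (D.η ν (t + 1)) (D.state w ν N x μ t ω)
        (μ t (D.state w ν N x μ t ω)) ∂Pr := by
  have h1 := hN.1
  have h2 := hN.2
  rw [hμ.cost_eq hw hN, hμ.integral_tail hw (Nat.lt_succ_self _) (by omega) fun t ht =>
    h t ⟨by have := ht.1; omega, by have := ht.2; omega⟩]
  simp [state_eq_init D w x μ le_rfl]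

theorem RiccatiCondition.cost_strategy (hw : IsNoise Pr w C) (h : D.RiccatiCondition ν)
    (hN : N ∈ Set.Icc 2 ν) (x : Fin n → ℝ) (l : ℕ → Fin m → ℝ) :
    D.cost Pr w ν N x (D.strategy ν N l) = D.value C ν (ν - N + 1) x := by
  rw [h.cost_eq hw hN (admissible_strategy hw l x), Finset.sum_eq_zero, add_zero]
  intro t ht
  rw [Finset.mem_Ico] at ht
  have : ∀ χ, D.excess (D.P ν (t + 1)) (D.η ν (t + 1)) χ (D.strategy ν N l t χ) = 0 := fun χ => by
    rw [strategy, if_neg (by omega), control_eq]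
    exact excess_nominal_add (h t ⟨by omega, by omega⟩) χ (l t)
  simp [this]

theorem RiccatiCondition.value_le_cost (hw : IsNoise Pr w C) (h : D.RiccatiCondition ν)
    (hN : N ∈ Set.Icc 2 ν) {x : Fin n → ℝ} {μ : ℕ → (Fin n → ℝ) → (Fin m → ℝ)}
    (hμ : D.Admissible Pr w ν N x μ) : D.value C ν (ν - N + 1) x ≤ D.cost Pr w ν N x μ := by
  rw [h.cost_eq hw hN hμ]
  refine le_add_of_nonneg_right (Finset.sum_nonneg fun t ht => integral_nonneg fun ω => ?_)
  rw [Finset.mem_Ico] at ht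
  exact excess_nonneg (h t ⟨by omega, by omega⟩) _ _

theorem RiccatiCondition.isOptimal_strategy (hw : IsNoise Pr w C) (h : D.RiccatiCondition ν)
    (hN : N ∈ Set.Icc 2 ν) (x : Fin n → ℝ) (l : ℕ → Fin m → ℝ) :
    D.IsOptimal Pr w ν N x (D.strategy ν N l) :=
  ⟨admissible_strategy hw l x, fun μ' hμ' => by
    rw [h.cost_strategy hw hN]
    exact h.value_le_cost hw hN hμ'⟩

/-- The value at `x` is attained by the strategy with `λ = 0`, so optimality means that a sum of
expectations of nonnegative excesses is zero. -/
theorem RiccatiCondition.isOptimal_iff_excess (hw : IsNoise Pr w C) (h : D.RiccatiCondition ν)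
    (hN : N ∈ Set.Icc 2 ν) (x : Fin n → ℝ) (μ : ℕ → (Fin n → ℝ) → (Fin m → ℝ)) :
    D.IsOptimal Pr w ν N x μ ↔ D.Admissible Pr w ν N x μ ∧
      ∀ t ∈ Set.Icc (ν - N + 1) (ν - 1), ∀ᵐ ω ∂Pr,
        D.excess (D.P ν (t + 1)) (D.η ν (t + 1)) (D.state w ν N x μ t ω)
          (μ t (D.state w ν N x μ t ω)) = 0 := by
  refine and_congr_right fun hμ => ?_
  have hN1 := hN.1
  have hN2 := hN.2
  have hnn : ∀ t ∈ Finset.Ico (ν - N + 1) ν, ∀ ω,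
      0 ≤ D.excess (D.P ν (t + 1)) (D.η ν (t + 1)) (D.state w ν N x μ t ω)
        (μ t (D.state w ν N x μ t ω)) := fun t ht ω => by
    rw [Finset.mem_Ico] at ht
    exact excess_nonneg (h t ⟨by omega, by omega⟩) _ _
  have h1 : (∀ μ', D.Admissible Pr w ν N x μ' → D.cost Pr w ν N x μ ≤ D.cost Pr w ν N x μ') ↔
      ∑ t ∈ Finset.Ico (ν - N + 1) ν,
      ∫ ω, D.excess (D.P ν (t + 1)) (D.η ν (t + 1)) (D.state w ν N x μ t ω)
        (μ t (D.state w ν N x μ t ω)) ∂Pr = 0 := by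
    have hs : 0 ≤ ∑ t ∈ Finset.Ico (ν - N + 1) ν,
        ∫ ω, D.excess (D.P ν (t + 1)) (D.η ν (t + 1)) (D.state w ν N x μ t ω)
          (μ t (D.state w ν N x μ t ω)) ∂Pr :=
      Finset.sum_nonneg fun t ht => integral_nonneg (hnn t ht)
    constructor
    · intro ho
      have := ho _ (admissible_strategy hw (fun _ => 0) x)
      rw [h.cost_strategy hw hN, h.cost_eq hw hN hμ] at this
      linarith
    · intro h0 μ' hμ'
      rw [h.cost_eq hw hN hμ, h0, add_zero]
      exact h.value_le_cost hw hN hμ'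
  rw [h1, Finset.sum_eq_zero_iff_of_nonneg fun t ht => integral_nonneg (hnn t ht)]
  refine forall_congr' fun t => ?_
  have hmem : t ∈ Finset.Ico (ν - N + 1) ν ↔ t ∈ Set.Icc (ν - N + 1) (ν - 1) := by
    rw [Finset.mem_Ico, Set.mem_Icc]
    omega
  rw [← hmem]
  refine forall_congr' fun ht => ?_
  rw [integral_eq_zero_iff_of_nonneg (hnn t ht)]
  · rfl
  · rw [Finset.mem_Ico] at ht
    exact integrable_excess (hμ.sqIntegrable_state hw ht.2.le)
      (hμ.sqIntegrable_control hw ht.1 ht.2) _ _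

theorem RiccatiCondition.isOptimal_iff (hw : IsNoise Pr w C) (h : D.RiccatiCondition ν)
    (hN : N ∈ Set.Icc 2 ν) (x : Fin n → ℝ) (μ : ℕ → (Fin n → ℝ) → (Fin m → ℝ)) :
    D.IsOptimal Pr w ν N x μ ↔ D.Admissible Pr w ν N x μ ∧
      ∀ t ∈ Set.Icc (ν - N + 1) (ν - 1), ∃ l : (Fin n → ℝ) → (Fin m → ℝ), Measurable l ∧
        ∀ᵐ ω ∂Pr, μ t (D.state w ν N x μ t ω)
          = D.control ν t (D.state w ν N x μ t ω) (l (D.state w ν N x μ t ω)) := by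
  rw [h.isOptimal_iff_excess hw hN]
  refine and_congr_right fun hμ => forall₂_congr fun t ht => ?_
  have hN1 := hN.1
  have hN2 := hN.2
  have ht1 := ht.1
  have ht2 := ht.2
  have hc : D.ConditionAt ν t := h t ⟨by omega, ht2⟩
  constructor
  · intro h0
    -- The deviation from the preferred control almost surely lies in `ker 𝐑` along the trajectory,
    -- so `1 - 𝐑† 𝐑` fixes it and it can serve as its own parameter.
    refine ⟨fun χ => μ t χ - D.nominal (D.P ν (t + 1)) (D.η ν (t + 1)) χ, ?_, ?_⟩
    · refine (hμ.measurable t ⟨by omega, ht2⟩).sub ?_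
      exact (by unfold nominal; fun_prop : Continuous fun χ : Fin n → ℝ =>
        D.nominal (D.P ν (t + 1)) (D.η ν (t + 1)) χ).measurable
    · filter_upwards [h0] with ω hω
      rw [excess_eq_zero_iff hc] at hω
      rw [control_eq, sub_mulVec, one_mulVec, ← mulVec_mulVec, hω, mulVec_zero, sub_zero,
        add_sub_cancel]
  · rintro ⟨l, -, hl⟩
    filter_upwards [hl] with ω hω
    rw [hω, control_eq]
    exact excess_nominal_add hc _ _

/-! ### Solvable forward problems -/

/-- The strategy with first control `u`, followed by the preferred feedback controls. -/
noncomputable def firstThenNominal (D : LQData n m) (ν N : ℕ) (u : Fin m → ℝ) (t : ℕ)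
    (χ : Fin n → ℝ) : Fin m → ℝ :=
  if t ≤ ν - N then 0 else if t = ν - N + 1 then u else
    D.nominal (D.P ν (t + 1)) (D.η ν (t + 1)) χ

theorem admissible_firstThenNominal (hw : IsNoise Pr w C) (u : Fin m → ℝ) (x : Fin n → ℝ) :
    D.Admissible Pr w ν N x (D.firstThenNominal ν N u) := by
  refine admissible_of_affine hw (fun t ht χ => if_pos ht) fun t ht => ?_
  by_cases h : t = ν - N + 1
  · refine ⟨0, u, fun χ => ?_⟩
    rw [firstThenNominal, if_neg (by omega), if_pos h, zero_mulVec, zero_add]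
  · obtain ⟨K, k, hK⟩ := D.exists_nominal_add_eq_affine (D.P ν (t + 1)) (D.η ν (t + 1)) 0
    refine ⟨K, k, fun χ => ?_⟩
    rw [firstThenNominal, if_neg (by omega), if_neg h, ← hK, add_zero]

/-- The condition after the first active time makes all later excesses vanish. At the first active
time nothing is assumed, so the cost is left as a polynomial in `u`. -/
theorem cost_firstThenNominal (hw : IsNoise Pr w C) (hN : N ∈ Set.Icc 2 ν)
    (hc : ∀ t ∈ Set.Ico (ν - N + 2) ν, D.ConditionAt ν t) (u : Fin m → ℝ) (x : Fin n → ℝ) :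
    D.cost Pr w ν N x (D.firstThenNominal ν N u) = D.stageCost x u +
      quad (D.P ν (ν - N + 1 + 1)) (D.η ν (ν - N + 1 + 1)) (D.γ C ν (ν - N + 1 + 1) +
        1 / 2 * (D.P ν (ν - N + 1 + 1) * C).trace) (D.A *ᵥ x + D.B *ᵥ u + D.d) := by
  have hN1 := hN.1
  have hN2 := hN.2
  have hμ := admissible_firstThenNominal (D := D) (ν := ν) (N := N) hw u x
  have h1 := hμ.integral_tail hw (T := ν - N + 1 + 1) (by omega) (by omega) hc
  have h2 := hμ.integral_stage_add_value hw (t := ν - N + 1) (by omega) (by omega)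
  rw [Finset.sum_eq_zero (s := Finset.Ico (ν - N + 1 + 1) ν)
    (f := fun t => ∫ ω, D.excess _ _ _ _ ∂Pr),
    add_zero] at h1
  · rw [hμ.cost_eq hw hN, Finset.sum_eq_sum_Ico_succ_bot (by omega)]
    have hu : D.firstThenNominal ν N u (ν - N + 1) x = u := by
      rw [firstThenNominal, if_neg (by omega), if_pos rfl]
    have h3 : ∀ ω, D.state w ν N x (D.firstThenNominal ν N u) (ν - N + 1) ω = x :=
      state_eq_init D w x _ le_rfl
    simp only [h3, hu, integral_const, probReal_univ, one_smul] at h2 ⊢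
    linarith
  · intro t ht
    rw [Finset.mem_Ico] at ht
    have : ∀ χ, D.excess (D.P ν (t + 1)) (D.η ν (t + 1)) χ (D.firstThenNominal ν N u t χ) = 0 :=
      fun χ => by
        rw [firstThenNominal, if_neg (by omega), if_neg (by omega)]
        have := excess_nominal_add (hc t ht) χ 0
        rwa [mulVec_zero, add_zero] at this
    simp [this]

theorem conditionAt_of_solvable (hw : IsNoise Pr w C) (hN : N ∈ Set.Icc 2 ν)
    (hc : ∀ t ∈ Set.Ico (ν - N + 2) ν, D.ConditionAt ν t)
    (hG : ∀ χ, ∃ ρ : ℝ, 0 < ρ ∧ ρ • χ ∈ closure {x | ∃ μ, D.IsOptimal Pr w ν N x μ}) :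
    D.ConditionAt ν (ν - N + 1) := by
  refine D.stepCondition_of_bounded _ (D.P_transpose ν _) _ _ hG ?_
  rintro x ⟨μ, hμ⟩
  refine ⟨D.cost Pr w ν N x μ - quad (D.Aᵀ * D.P ν (ν - N + 1 + 1) * D.A + D.Q)
    (D.Aᵀ *ᵥ (D.η ν (ν - N + 1 + 1) + D.P ν (ν - N + 1 + 1) *ᵥ D.d) + D.q)
    (1 / 2 * (D.d ⬝ᵥ D.P ν (ν - N + 1 + 1) *ᵥ D.d) + D.η ν (ν - N + 1 + 1) ⬝ᵥ D.d +
      (D.γ C ν (ν - N + 1 + 1) + 1 / 2 * (D.P ν (ν - N + 1 + 1) * C).trace)) x, fun u => ?_⟩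
  have := hμ.2 _ (admissible_firstThenNominal hw u x)
  rw [cost_firstThenNominal hw hN hc, D.stageCost_add_quad _ (D.P_transpose ν _)] at this
  linarith

theorem riccatiCondition_of_solvable (hw : IsNoise Pr w C)
    (hG : ∀ N ∈ Set.Icc 2 ν, ∀ χ, ∃ ρ : ℝ, 0 < ρ ∧
      ρ • χ ∈ closure {x | ∃ μ, D.IsOptimal Pr w ν N x μ}) : D.RiccatiCondition ν := by
  have ind : ∀ k < ν, ∀ t ∈ Set.Ico (ν - k) ν, D.ConditionAt ν t := by
    intro k
    induction k with
    | zero =>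
      intro _ t ht
      have := ht.1
      have := ht.2
      omega
    | succ k ih =>
      intro hk t ht
      have ih := ih (by omega)
      by_cases h : ν - k ≤ t
      · exact ih t ⟨h, ht.2⟩
      -- The only new time is `t = ν - (k + 1)`, the first active time of horizon `k + 2`.
      · have hN : k + 2 ∈ Set.Icc 2 ν := ⟨by omega, by omega⟩
        have := conditionAt_of_solvable hw hN
          (fun s hs => ih s ⟨by have := hs.1; omega, hs.2⟩) (hG _ hN)
        have ht1 := ht.1
        rwa [show ν - (k + 2) + 1 = t by omega] at this
  intro t ht
  have := ht.1
  have := ht.2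
  exact ind (ν - t) (by omega) t ⟨by omega, by omega⟩

end LQData

/-- Under persistent excitation, a set that contains almost every value of `xbar` accumulates at
a positive multiple of every vector. -/
theorem PersistentExcitation.exists_smul_mem_closure {n : ℕ} {Ω : Type*} [MeasurableSpace Ω]
    {Pr : Measure Ω} [IsProbabilityMeasure Pr] {ν : ℕ} {xbar : Ω → Fin n → ℝ} {N : Ω → ℕ}
    (h : PersistentExcitation Pr ν xbar N) (hNν : ∀ᵐ ω ∂Pr, N ω ∈ Set.Icc 2 ν)
    {G : Set (Fin n → ℝ)} (hG : ∀ᵐ ω ∂Pr, xbar ω ∈ G) (χ : Fin n → ℝ) :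
    ∃ ρ : ℝ, 0 < ρ ∧ ρ • χ ∈ closure G := by
  -- Some horizon length has positive probability. One suffices, even if it differs from the horizon
  -- of the forward problem behind `G`, since `G` has full measure for the whole law of `xbar`.
  obtain ⟨N₀, hN₀, hpos⟩ : ∃ N₀ ∈ Set.Icc 2 ν, 0 < Pr {ω | N ω = N₀} := by
    by_contra! hcon
    have h1 : ∀ᵐ ω ∂Pr, ∀ k : ℕ, k ∈ Set.Icc 2 ν → N ω ≠ k := by
      refine ae_all_iff.mpr fun k => ?_
      by_cases hk : k ∈ Set.Icc 2 ν
      · have : ∀ᵐ ω ∂Pr, N ω ≠ k := by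
          rw [ae_iff]
          simpa using hcon k hk
        filter_upwards [this] with ω hω _ using hω
      · exact ae_of_all _ fun ω h => absurd h hk
    obtain ⟨ω, h2, h3⟩ := (h1.and hNν).exists
    exact h2 _ h3 rfl
  obtain ⟨ρ, hρ, hball⟩ := h.excitation N₀ hN₀ hpos χ
  refine ⟨ρ, hρ, ?_⟩
  have hmem : WithLp.toLp 2 (ρ • χ) ∈
      closure (WithLp.toLp 2 '' G : Set (EuclideanSpace ℝ (Fin n))) := by
    refine Metric.mem_closure_iff.mpr fun ε hε => ?_
    -- Conditioning preserves null sets, so a ball of positive conditional probability meets `G`.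
    have h1 : ∀ᵐ ω ∂(ProbabilityTheory.cond Pr {ω | N ω = N₀}), xbar ω ∈ G :=
      cond_absolutelyContinuous.ae_le hG
    have h2 : ∃ᵐ ω ∂(ProbabilityTheory.cond Pr {ω | N ω = N₀}),
        WithLp.toLp 2 (xbar ω) ∈ Metric.ball (WithLp.toLp 2 (ρ • χ)) ε :=
      frequently_ae_iff.mpr (hball ε hε).ne'
    obtain ⟨ω, h3, h4⟩ := (h2.and_eventually h1).exists
    exact ⟨_, ⟨_, h4, rfl⟩, Metric.mem_ball'.mp h3⟩
  have hcont : Continuous (WithLp.ofLp : EuclideanSpace ℝ (Fin n) → Fin n → ℝ) :=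
    PiLp.continuous_ofLp 2 _
  have := image_closure_subset_closure_image hcont ⟨_, hmem, rfl⟩
  rw [Set.image_image] at this
  simpa using this

end IndefLQ

/-! ### The main theorem -/

theorem theorem1 {n m : ℕ} {Ω : Type*} [MeasurableSpace Ω] (Pr : Measure Ω) [IsProbabilityMeasure Pr]
    (D : IndefLQ.LQData n m) (ν : ℕ)
    (xbar : Ω → Fin n → ℝ) (hxbar : Measurable xbar)
    (N : Ω → ℕ) (hN : Measurable N) (hNν : ∀ᵐ ω ∂Pr, N ω ∈ Set.Icc 2 ν)
    (w v : ℕ → Ω → Fin n → ℝ) (Sw Sv : Matrix (Fin n) (Fin n) ℝ)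
    (hiid : IndefLQ.IIDAssumption Pr xbar N w v Sw Sv)
    (hpe : IndefLQ.PersistentExcitation Pr ν xbar N) :
    -- the equivalence of the four statements
    List.TFAE [
      D.ForwardSolvable Pr w ν xbar,
      D.RiccatiCondition ν,
      D.LMICondition ν,
      ∃ V, D.SolvesHJB Pr w ν V ∧ D.IsQuadraticValue Sw ν V] ∧
    -- boundedness from below suffices in the fourth statement: every solution in the weak sense
    -- has attained minima and is the quadratic one
    (∀ V, D.SolvesHJBInf Pr w ν V → D.SolvesHJB Pr w ν V ∧ D.IsQuadraticValue Sw ν V) ∧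
    -- the optimal controls
    (D.RiccatiCondition ν → ∀ N₀ ∈ Set.Icc 2 ν, ∀ x : Fin n → ℝ,
      (∀ l : ℕ → Fin m → ℝ, D.IsOptimal Pr w ν N₀ x (D.strategy ν N₀ l)) ∧
      ∀ μ : ℕ → (Fin n → ℝ) → (Fin m → ℝ), D.IsOptimal Pr w ν N₀ x μ ↔
        D.Admissible Pr w ν N₀ x μ ∧
        ∀ t ∈ Set.Icc (ν - N₀ + 1) (ν - 1), ∃ l : (Fin n → ℝ) → (Fin m → ℝ), Measurable l ∧
          ∀ᵐ ω ∂Pr, μ t (D.state w ν N₀ x μ t ω)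
            = D.control ν t (D.state w ν N₀ x μ t ω) (l (D.state w ν N₀ x μ t ω))) := by
  have hw := hiid.process_noise
  refine ⟨?_, fun V hV => (hV.spec hw).2, fun h N₀ hN₀ x =>
    ⟨h.isOptimal_strategy hw hN₀ x, h.isOptimal_iff hw hN₀ x⟩⟩
  tfae_have 1 → 2 := fun h => IndefLQ.LQData.riccatiCondition_of_solvable hw fun N₀ hN₀ χ =>
    hpe.exists_smul_mem_closure hNν (ae_of_ae_map hxbar.aemeasurable (h N₀ hN₀)) χ
  tfae_have 2 → 1 := fun h N₀ hN₀ =>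
    ae_of_all _ fun x => ⟨_, h.isOptimal_strategy hw hN₀ x fun _ => 0⟩
  tfae_have 2 ↔ 3 := D.riccatiCondition_iff_lmiCondition ν
  tfae_have 2 → 4 := fun h => ⟨_, h.solvesHJB hw⟩
  tfae_have 4 → 2 := fun ⟨V, hV, _⟩ =>
    (IndefLQ.LQData.SolvesHJBInf.spec hw ⟨hV.1, fun t ht χ => (hV.2 t ht χ).isGLB⟩).1
  tfae_finish
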